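/- Let $(\Omega,\mathcal A,\mathbb P)$ be a probability space and let $(a_n)_{n\ge1}$ be a triangular scheme, that is, each $a_n=(a_n(p,q))_{1\le p,q\le n}$ is a random real symmetric $n\times n$ matrix on $\Omega$. Call pairs $(p,q)$ and $(p',q')$ fundamentally different if $\{p,q\}\ne\{p',q'\}$. For $\alpha>0$ the scheme is $\alpha$-almost uncorrelated with constants $(C_k)_k$, $(C_n^{(l)})_{n,l}$, where $\lim_{n\to\infty}C_n^{(l)}=0$ for each $l\ge1$, if for all $N,l\ge1$, all pairwise fundamentally different pairs $(p_1,q_1),\dots,(p_l,q_l)\in\{1,\dots,N\}^2$ and all $n\ge N$: (AAU1) for all integers $\delta_1,\dots,\delta_l\ge1$ the following expectation exists and $$\bigl|\mathbb E\,a_n(p_1,q_1)^{\delta_1}\cdots a_n(p_l,q_l)^{\delta_l}\bigr|\le \frac{C_{\delta_1+\dots+\delta_l}}{n^{\alpha\cdot\#\{i:\delta_i=1\}}};$$ (AAU2) $\bigl|\mathbb E\,a_n(p_1,q_1)^2\cdots a_n(p_l,q_l)^2-1\bigr|\le C_n^{(l)}$. It is strongly $\alpha$-almost uncorrelated with constants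 $(C_k)_k$, $(C_n^{(l)})_{n,l}$, $(D_n^{(l)})_{n,l}$ if, moreover, $\lim_{n\to\infty}D_n^{(l)}=0$ for each $l\ge1$ and, for the same $N,l,n$ and pairs, (AAU3) $\bigl|\mathbb E\,a_n(p_1,q_1)^4\bigl(a_n(p_2,q_2)^2\cdots a_n(p_l,q_l)^2-1\bigr)\bigr|\le D_n^{(l)}$. The scheme is a Wigner scheme if for every $n$ the family $(a_n(i,j))_{1\le i\le j\le n}$ is independent, all entries have mean $0$ and variance $1$, and for every integer $p\ge1$ we have $\sup_n\sup_{i,j\le n}\mathbb E|a_n(i,j)|^p<\infty$. Let $b=(b_n)_{n\ge1}$ be a sequence of bandwidths: each $b_n$ is either an odd natural number smaller than $n$ or equal to $n$. Suppose that $\liminf_{n\to\infty}b_n/n>0$. Let $X_n$ be the periodic band matrix with $X_n(i,j)=b_n^{-1/2}a_n(i,j)$ if $b_n=n$ or $|i-j|\le\frac{b_n-1}2$ or $|i-j|\ge n-\frac{b_n-1}2$, and $X_n(i,j)=0$ otherwise. (Full matrices are the case $b_n=n$.) Let $\sigma_n=\frac1n\sum_{i=1}^n\delta_{\lambda_i}$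 be the empirical distribution of the eigenvalues $\lambda_1\le\dots\le\lambda_n$ of $X_n$, and let $\sigma$ be the semicircle distribution, with Lebesgue density $\frac1{2\pi}\sqrt{4-x^2}\,\mathbf 1_{[-2,2]}(x)$. Assume that one of the following conditions holds: (2′) $(a_n)_n$ is $\alpha$-almost uncorrelated (with some constants as above) for some $\alpha\ge\frac12$, and all entries are $\{-1,1\}$-valued (almost surely); (3′) $(a_n)_n$ is strongly $\alpha$-almost uncorrelated for some $\alpha>\frac12$, with constants such that $\sum_n C_n^{(l)}$ and $\sum_n\frac1nD_n^{(l)}$ converge absolutely for every $l\ge1$; (4′) $(a_n)_n$ is a Wigner scheme. Then the semicircle law holds almost surely for $(X_n)_n$: for every bounded continuous $f:\mathbb R\to\mathbb R$, almost surely $\int f\,d\sigma_n\to\int f\,d\sigma$ as $n\to\infty$. -/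

import Mathlib

open Filter Topology MeasureTheory ProbabilityTheory
open scoped ENNReal BoundedContinuousFunction

noncomputable section

namespace BandSemicircle

/-- A triangular scheme: for every `n` a random real symmetric `n × n` matrix, all defined on the
same measurable space `Ω`. The indices `1, …, n` are represented by `Fin n`. -/
structure TriangularScheme (Ω : Type*) [MeasurableSpace Ω] where
  /-- The `n`-th matrix at the point `ω`. -/
  mat : (n : ℕ) → Ω → Matrix (Fin n) (Fin n) ℝ
  measurable_entry : ∀ (n : ℕ) (p q : Fin n), Measurable fun ω => mat n ω p q
  isSymm : ∀ (n : ℕ) (ω : Ω), (mat n ω).IsSymm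

/-- The pairs `x` and `y` are fundamentally different if they differ as unordered pairs. -/
def FundamentallyDifferent {ι : Type*} (x y : ι × ι) : Prop :=
  s(x.1, x.2) ≠ s(y.1, y.2)

section Conditions

variable {Ω : Type*} [MeasurableSpace Ω]

/-- The entry `a_n(p, q)` for an index pair `(p, q)` from `[N] × [N]`, where `N ≤ n`. -/
def TriangularScheme.entry (a : TriangularScheme Ω) {N n : ℕ} (h : N ≤ n) (x : Fin N × Fin N)
    (ω : Ω) : ℝ :=
  a.mat n ω (Fin.castLE h x.1) (Fin.castLE h x.2)

/-- Distinct decay and boundedness condition. The existence of the expectations (of mixed moments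
of all orders) is part of the condition. -/
def AAU1 (P : Measure Ω) (a : TriangularScheme Ω) (α : ℝ) (C : ℕ → ℝ) : Prop :=
  ∀ (N l : ℕ), 1 ≤ l → ∀ x : Fin l → Fin N × Fin N,
    (Pairwise fun i j => FundamentallyDifferent (x i) (x j)) →
    ∀ δ : Fin l → ℕ, (∀ i, 1 ≤ δ i) → ∀ (n : ℕ) (h : N ≤ n),
      Integrable (fun ω => ∏ i, a.entry h (x i) ω ^ δ i) P ∧
      |∫ ω, ∏ i, a.entry h (x i) ω ^ δ i ∂P| ≤
        C (∑ i, δ i) / (n : ℝ) ^ (α * ((Finset.univ.filter fun i => δ i = 1).card : ℝ))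

/-- Second moment condition; `C l n` stands for `C_n^{(l)}`. -/
def AAU2 (P : Measure Ω) (a : TriangularScheme Ω) (C : ℕ → ℕ → ℝ) : Prop :=
  ∀ (N l : ℕ), 1 ≤ l → ∀ x : Fin l → Fin N × Fin N,
    (Pairwise fun i j => FundamentallyDifferent (x i) (x j)) →
    ∀ (n : ℕ) (h : N ≤ n),
      |(∫ ω, ∏ i, a.entry h (x i) ω ^ 2 ∂P) - 1| ≤ C l n

/-- Fourth moment condition; `D l n` stands for `D_n^{(l)}`, and there are `l = m + 1` pairs. -/
def AAU3 (P : Measure Ω) (a : TriangularScheme Ω) (D : ℕ → ℕ → ℝ) : Prop :=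
  ∀ (N m : ℕ) (x : Fin (m + 1) → Fin N × Fin N),
    (Pairwise fun i j => FundamentallyDifferent (x i) (x j)) →
    ∀ (n : ℕ) (h : N ≤ n),
      |∫ ω, a.entry h (x 0) ω ^ 4 * ((∏ i : Fin m, a.entry h (x i.succ) ω ^ 2) - 1) ∂P| ≤
        D (m + 1) n

/-- `a` is `α`-almost uncorrelated with constants `C k` (standing for `C_k`) and `C' m n`
(standing for `C_n^{(m)}`). -/
structure AlmostUncorrelatedWith (P : Measure Ω) (a : TriangularScheme Ω) (α : ℝ)
    (C : ℕ → ℝ) (C' : ℕ → ℕ → ℝ) : Prop where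
  pos : 0 < α
  tendsto_C' : ∀ m, 1 ≤ m → Tendsto (C' m) atTop (𝓝 0)
  aau1 : AAU1 P a α C
  aau2 : AAU2 P a C'

/-- `a` is `α`-almost uncorrelated. -/
def AlmostUncorrelated (P : Measure Ω) (a : TriangularScheme Ω) (α : ℝ) : Prop :=
  ∃ (C : ℕ → ℝ) (C' : ℕ → ℕ → ℝ), AlmostUncorrelatedWith P a α C C'

/-- `a` is strongly `α`-almost uncorrelated with constants `C k`, `C' m n` and `D m n` (the last
standing for `D_n^{(m)}`). -/
structure StronglyAlmostUncorrelatedWith (P : Measure Ω) (a : TriangularScheme Ω) (α : ℝ)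
    (C : ℕ → ℝ) (C' D : ℕ → ℕ → ℝ) : Prop extends AlmostUncorrelatedWith P a α C C' where
  tendsto_D : ∀ m, 1 ≤ m → Tendsto (D m) atTop (𝓝 0)
  aau3 : AAU3 P a D

/-- Wigner schemes. -/
structure IsWignerScheme (P : Measure Ω) (a : TriangularScheme Ω) : Prop where
  indep : ∀ n : ℕ, iIndepFun
    (fun (x : {x : Fin n × Fin n // x.1 ≤ x.2}) (ω : Ω) => a.mat n ω x.1.1 x.1.2) P
  mean_zero : ∀ (n : ℕ) (i j : Fin n), ∫ ω, a.mat n ω i j ∂P = 0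
  variance_one : ∀ (n : ℕ) (i j : Fin n), variance (fun ω => a.mat n ω i j) P = 1
  moments : ∀ p : ℕ, 1 ≤ p → ∃ C : ℝ, 0 < C ∧ ∀ (n : ℕ) (i j : Fin n),
    Integrable (fun ω => |a.mat n ω i j| ^ p) P ∧ ∫ ω, |a.mat n ω i j| ^ p ∂P ≤ C

end Conditions

/-- `b` is an `n`-bandwidth: an odd natural number smaller than `n`, or `n` itself. -/
def IsBandwidth (n b : ℕ) : Prop := (b < n ∧ Odd b) ∨ b = n

/-- The index pair `(i, j)` is `b`-relevant. -/
def Relevant {n : ℕ} (b : ℕ) (i j : Fin n) : Prop :=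
  b = n ∨ |(i : ℝ) - (j : ℝ)| ≤ ((b : ℝ) - 1) / 2 ∨
    (n : ℝ) - ((b : ℝ) - 1) / 2 ≤ |(i : ℝ) - (j : ℝ)|

open Classical in
/-- The periodic band matrix obtained from `A` by setting the non-relevant entries to zero. -/
def band {n : ℕ} (b : ℕ) (A : Matrix (Fin n) (Fin n) ℝ) : Matrix (Fin n) (Fin n) ℝ :=
  Matrix.of fun i j => if Relevant b i j then A i j else 0

theorem relevant_comm {n b : ℕ} (i j : Fin n) : Relevant b i j ↔ Relevant b j i := by
  unfold Relevant
  rw [abs_sub_comm]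

theorem band_isSymm {n : ℕ} (b : ℕ) {A : Matrix (Fin n) (Fin n) ℝ} (hA : A.IsSymm) :
    (band b A).IsSymm := by
  ext i j
  simp only [band, Matrix.transpose_apply, Matrix.of_apply]
  classical
  exact if_congr (relevant_comm j i) (hA.apply i j) rfl

/-- The matrix `X_n` (at the point `ω`) of the sequence of periodic random band matrices based on
the triangular scheme `a` with bandwidth `b`. -/
def bandMatrix {Ω : Type*} [MeasurableSpace Ω] (a : TriangularScheme Ω) (b : ℕ → ℕ) (n : ℕ)
    (ω : Ω) : Matrix (Fin n) (Fin n) ℝ :=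
  (1 / √(b n : ℝ)) • band (b n) (a.mat n ω)

theorem bandMatrix_isHermitian {Ω : Type*} [MeasurableSpace Ω] (a : TriangularScheme Ω)
    (b : ℕ → ℕ) (n : ℕ) (ω : Ω) : (bandMatrix a b n ω).IsHermitian := by
  have h := (band_isSymm (b n) (a.isSymm n ω)).smul (1 / √(b n : ℝ))
  rw [Matrix.IsHermitian, Matrix.conjTranspose_eq_transpose_of_trivial]
  exact h

/-- The empirical spectral distribution of a real symmetric `n × n` matrix: the uniform
distribution on its eigenvalues, counted with multiplicity. -/
def esd {n : ℕ} {A : Matrix (Fin n) (Fin n) ℝ} (hA : A.IsHermitian) : Measure ℝ :=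
  (n : ℝ≥0∞)⁻¹ • ∑ i, Measure.dirac (hA.eigenvalues i)

/-- The semicircle distribution. -/
def semicircle : Measure ℝ :=
  volume.withDensity fun x =>
    ENNReal.ofReal ((Set.Icc (-2) 2).indicator (fun y => 1 / (2 * Real.pi) * √(4 - y ^ 2)) x)

/-- The semicircle law holds almost surely for the random matrices `X_n`: their empirical spectral
distributions converge to the semicircle distribution weakly almost surely. -/
def SemicircleLawAlmostSurely {Ω : Type*} [MeasurableSpace Ω] (P : Measure Ω)
    (X : (n : ℕ) → Ω → Matrix (Fin n) (Fin n) ℝ) (hX : ∀ n ω, (X n ω).IsHermitian) : Prop :=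
  ∀ f : ℝ →ᵇ ℝ, ∀ᵐ ω ∂P,
    Tendsto (fun n => ∫ x, f x ∂(esd (hX n ω))) atTop (𝓝 (∫ x, f x ∂semicircle))

end BandSemicircle

end

/-! The proof is the moment method with a second moment estimate strong enough for almost sure
convergence. The trace of the `k`-th power of the band matrix is `b_n^(-k/2)` times a sum, over
closed walks of length `k` along relevant pairs, of products of entries (`trace_bandMatrix_pow`).
The walks are split into double tree walks, which traverse each of their `k/2` edges exactly twice
and visit `k/2 + 1` vertices, and the rest.

All three hypotheses are reduced to `MomentBounds`: each entry occurring with exponent one in a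
mixed moment gains a factor `n^(-1/2)`, and expected products of squares deviate from `1` by a
summable error. For two walks outside the tree class, twice the number of vertices in the union is
at most `2k` plus the number of edges used exactly once by the pair (`two_mul_card_union_verts_le`).
The loss from counting vertices is therefore paid for by the decay in single edges, and after
normalization the second moment of the rest is `O(1/n^2)`, using that `b_n` is at least of order
`n`. For tree walks the weight is compared with `1`: pairs without a common edge contribute the
summable error, and pairs with a common edge are too few to contribute more than `O(1/n^2)`.
Summable second moments give almost sure convergence to zero.

What remains is the number of tree walks. A tree walk records the top of a stack while vertices are
pushed and popped; up to `O(n^(k/2))` exceptions this is a bijection. In a `b`-regular relation the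
stack words are counted exactly by `n b^(k/2)` times the number of lattice excursions of length `k`
(`card_accepts`, `abs_card_treeWalks_sub_le`). Those excursion numbers are the semicircle moments,
because the three-term recursion of the Chebyshev polynomials orthogonal for the semicircle is the
recursion of the lattice paths (`integral_pow_mul_chebyshev_semicircle`). Polynomial approximation,
with a high even moment controlling the tails, turns convergence of moments into weak convergence.
-/

namespace BandSemicircle

/-! ### Vertices and edges of walks: cohomological counting inequalities. -/

section Walks

variable {V : Type*}

/-- The list of (unordered) edges traversed by the walk that starts at `x` and then visits the
vertices of the list one after another. -/
def edges : V → List V → List (Sym2 V)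
  | _, [] => []
  | x, y :: l => s(x, y) :: edges y l

/-- The last vertex of the walk that starts at `x` and then visits the vertices of the list. -/
def endpoint : V → List V → V
  | x, [] => x
  | _, y :: l => endpoint y l

/-- The mod `2` coboundary of a function on the vertices. -/
def coboundary (f : V → ZMod 2) : Sym2 V → ZMod 2 :=
  Sym2.lift ⟨fun a b => f a + f b, fun _ _ => add_comm _ _⟩

@[simp] theorem coboundary_mk (f : V → ZMod 2) (a b : V) : coboundary f s(a, b) = f a + f b := rfl

@[simp] theorem edges_length (x : V) (l : List V) : (edges x l).length = l.length := by
  induction l generalizing x with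
  | nil => rfl
  | cons y l ih => simp [edges, ih]

theorem zmod_two_add_eq_zero {a b : ZMod 2} : a + b = 0 ↔ a = b := by
  revert a b; decide

/-- The coboundary sums to zero along closed walks. -/
theorem sum_coboundary_edges (f : V → ZMod 2) (x : V) (l : List V) :
    ((edges x l).map (coboundary f)).sum = f x + f (endpoint x l) := by
  induction l generalizing x with
  | nil => exact (zmod_two_add_eq_zero.2 rfl).symm
  | cons y l ih =>
    simp only [edges, List.map_cons, List.sum_cons, coboundary_mk, ih, endpoint]
    have : f y + f y = 0 := zmod_two_add_eq_zero.2 rfl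
    linear_combination this

variable [DecidableEq V]

/-- The set of vertices visited by a walk. -/
def verts (x : V) (l : List V) : Finset V := insert x l.toFinset

theorem verts_cons (x y : V) (l : List V) : verts x (y :: l) = insert x (verts y l) := by
  simp [verts]

theorem self_mem_verts (x : V) (l : List V) : x ∈ verts x l := by simp [verts]

theorem mem_verts_of_mem_edges {x : V} {l : List V} {e : Sym2 V} (he : e ∈ edges x l) {v : V}
    (hv : v ∈ e) : v ∈ verts x l := by
  induction l generalizing x with
  | nil => simp [edges] at he
  | cons y l ih =>
    rw [verts_cons]
    simp only [edges, List.mem_cons] at he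
    rcases he with rfl | he
    · rcases Sym2.mem_iff.1 hv with rfl | rfl
      · simp
      · exact Finset.mem_insert_of_mem (self_mem_verts _ _)
    · exact Finset.mem_insert_of_mem (ih he)

/-- A function with vanishing coboundary along a walk is constant on the walk. -/
theorem eq_of_coboundary_edges (f : V → ZMod 2) (x : V) (l : List V)
    (h : ∀ e ∈ edges x l, coboundary f e = 0) : ∀ y ∈ verts x l, f y = f x := by
  induction l generalizing x with
  | nil => simp [verts]
  | cons z l ih =>
    intro y hy
    rw [verts_cons, Finset.mem_insert] at hy
    have hz : f x = f z := zmod_two_add_eq_zero.1 (h s(x, z) (by simp [edges]))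
    rcases hy with rfl | hy
    · rfl
    · rw [hz]
      exact ih z (fun e he => h e (by simp [edges, he])) y hy

/-- If the edges of `E` connect the vertices of `S` (tested by functions to `ZMod 2`), then `S` has
at most one element more than `E`. -/
theorem card_le_card_add_one_of_connected (S : Finset V) (E : Finset (Sym2 V))
    (h : ∀ f : V → ZMod 2, (∀ e ∈ E, coboundary f e = 0) → ∀ x ∈ S, ∀ y ∈ S, f x = f y) :
    S.card ≤ E.card + 1 := by
  rcases S.eq_empty_or_nonempty with rfl | ⟨x₀, hx₀⟩
  · simp
  -- Normalize functions to vanish at `x₀`. Their coboundary on `E` then determines them on `S`, so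
  -- `2 ^ (|S| - 1) ≤ 2 ^ |E|`; this replaces a spanning tree argument.
  let ext : (↥(S.erase x₀) → ZMod 2) → V → ZMod 2 :=
    fun g v => if hv : v ∈ S.erase x₀ then g ⟨v, hv⟩ else 0
  let Φ : (↥(S.erase x₀) → ZMod 2) → (↥E → ZMod 2) := fun g e => coboundary (ext g) e
  have hΦ : Function.Injective Φ := by
    intro g g' hg
    have key : ∀ e ∈ E, coboundary (fun v => ext g v + ext g' v) e = 0 := by
      intro e he
      have := congrFun hg ⟨e, he⟩
      simp only [Φ] at this
      induction e with
      | _ p q =>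
        simp only [coboundary_mk] at this ⊢
        have h2 := zmod_two_add_eq_zero.2 this
        linear_combination h2
    funext v
    have h1 := h _ key v (Finset.mem_of_mem_erase v.2) x₀ hx₀
    have h2 : ∀ g, ext g x₀ = 0 := fun g => by simp [ext]
    have h3 : ∀ g : ↥(S.erase x₀) → ZMod 2, ext g v = g v := fun g => by
      simp only [ext]
      rw [dif_pos v.2]
    simp only [h2, h3, add_zero] at h1
    exact zmod_two_add_eq_zero.1 h1
  have hcard := Fintype.card_le_of_injective Φ hΦ
  simp only [Fintype.card_fun, ZMod.card, Fintype.card_coe] at hcard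
  have := (Nat.pow_le_pow_iff_right (by norm_num : 1 < 2)).1 hcard
  rw [Finset.card_erase_of_mem hx₀] at this
  omega

/-- Along a closed walk the coboundary of an edge that is traversed an odd number of times is
determined by the other edges. -/
theorem coboundary_eq_zero_of_odd (f : V → ZMod 2) (x : V) (l : List V) (hl : endpoint x l = x)
    (e₀ : Sym2 V) (h₀ : Odd ((edges x l).count e₀))
    (h : ∀ e ∈ edges x l, e ≠ e₀ → coboundary f e = 0) : coboundary f e₀ = 0 := by
  -- The sum around the closed walk vanishes mod `2`, and only `e₀` survives in it, with an odd
  -- coefficient.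
  have h1 := sum_coboundary_edges f x l
  rw [hl, zmod_two_add_eq_zero.2 rfl, Finset.sum_list_map_count,
    Finset.sum_eq_single e₀] at h1
  · obtain ⟨m, hm⟩ := h₀
    rw [hm, nsmul_eq_mul] at h1
    push_cast at h1
    have h2 : (2 : ZMod 2) = 0 := rfl
    rw [h2] at h1
    simpa using h1
  · intro e he hne
    rw [h e (List.mem_toFinset.1 he) hne, smul_zero]
  · intro hn
    rw [List.count_eq_zero_of_not_mem (fun h => hn (List.mem_toFinset.2 h)), zero_smul]

/-- The number of edges that occur exactly once in a list. -/
def singles (L : List (Sym2 V)) : ℕ := (L.toFinset.filter fun e => L.count e = 1).card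

/-- Every edge that is not single accounts for at least two entries of the list. -/
theorem two_mul_card_toFinset_le {L : List (Sym2 V)} :
    2 * L.toFinset.card ≤ L.length + singles L := by
  have h1 : L.length = ∑ e ∈ L.toFinset, L.count e := (List.sum_toFinset_count_eq_length L).symm
  rw [h1, singles, Finset.card_filter, ← Finset.sum_add_distrib, mul_comm, ← smul_eq_mul,
    ← Finset.sum_const]
  refine Finset.sum_le_sum fun e he => ?_
  have := List.count_pos_iff.2 (List.mem_toFinset.1 he)
  split_ifs <;> omega

theorem odd_of_singles_pos {L : List (Sym2 V)} (h : 0 < singles L) : ∃ e, Odd (L.count e) := by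
  obtain ⟨e, he⟩ := Finset.card_pos.1 h
  exact ⟨e, by rw [(Finset.mem_filter.1 he).2]; exact odd_one⟩

theorem exists_odd_count_of_odd_length {L : List (Sym2 V)} (h : Odd L.length) :
    ∃ e, Odd (L.count e) := by
  by_contra! hc
  rw [← List.sum_toFinset_count_eq_length L] at h
  exact (Nat.not_odd_iff_even.2 (Finset.even_sum _ fun e _ => Nat.not_odd_iff_even.1 (hc e))) h

theorem card_verts_le (x : V) (l : List V) :
    (verts x l).card ≤ (edges x l).toFinset.card + 1 := by
  refine card_le_card_add_one_of_connected _ _ fun f hf y hy z hz => ?_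
  have h := eq_of_coboundary_edges f x l fun e he => hf e (List.mem_toFinset.2 he)
  rw [h y hy, h z hz]

/-- An edge traversed an odd number of times by a closed walk is no bridge of its graph: the
remaining edges still connect all vertices. This saves one compared with `card_verts_le`. -/
theorem card_verts_le_of_odd (x : V) (l : List V) (hl : endpoint x l = x) (e₀ : Sym2 V)
    (h₀ : Odd ((edges x l).count e₀)) : (verts x l).card ≤ (edges x l).toFinset.card := by
  have hmem : e₀ ∈ (edges x l).toFinset := List.mem_toFinset.2 (List.count_pos_iff.1 h₀.pos)
  have := card_le_card_add_one_of_connected (verts x l) ((edges x l).toFinset.erase e₀)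
    fun f hf y hy z hz => by
      have h1 : ∀ e ∈ edges x l, e ≠ e₀ → coboundary f e = 0 := fun e he hne =>
        hf e (Finset.mem_erase.2 ⟨hne, List.mem_toFinset.2 he⟩)
      have h2 := coboundary_eq_zero_of_odd f x l hl e₀ h₀ h1
      have h := eq_of_coboundary_edges f x l fun e he => by
        by_cases hne : e = e₀
        · rw [hne, h2]
        · exact h1 e he hne
      rw [h y hy, h z hz]
  rw [Finset.card_erase_of_mem hmem] at this
  have := Finset.card_pos.2 ⟨e₀, hmem⟩
  omega

theorem card_union_verts_le (x : V) (l : List V) (x' : V) (l' : List V)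
    (hm : ¬ Disjoint (verts x l) (verts x' l')) :
    (verts x l ∪ verts x' l').card ≤ (edges x l ++ edges x' l').toFinset.card + 1 := by
  obtain ⟨w, hw, hw'⟩ := Finset.not_disjoint_iff.1 hm
  refine card_le_card_add_one_of_connected _ _ fun f hf => ?_
  have h := eq_of_coboundary_edges f x l fun e he => hf e (by simp [he])
  have h' := eq_of_coboundary_edges f x' l' fun e he => hf e (by simp [he])
  have key : ∀ y ∈ verts x l ∪ verts x' l', f y = f w := by
    intro y hy
    rcases Finset.mem_union.1 hy with hy | hy
    · rw [h y hy, h w hw]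
    · rw [h' y hy, h' w hw']
  intro y hy z hz
  rw [key y hy, key z hz]

/-- A common vertex makes the union connected, and `e₀` remains superfluous for connectedness. Only
the walk with the odd edge needs to be closed. -/
theorem card_union_verts_le_of_odd (x : V) (l : List V) (x' : V) (l' : List V)
    (hl : endpoint x l = x) (hm : ¬ Disjoint (verts x l) (verts x' l'))
    (e₀ : Sym2 V) (h₀ : Odd ((edges x l).count e₀)) :
    (verts x l ∪ verts x' l').card ≤ (edges x l ++ edges x' l').toFinset.card := by
  obtain ⟨w, hw, hw'⟩ := Finset.not_disjoint_iff.1 hm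
  have hmem : e₀ ∈ (edges x l ++ edges x' l').toFinset :=
    List.mem_toFinset.2 (List.mem_append_left _ (List.count_pos_iff.1 h₀.pos))
  have := card_le_card_add_one_of_connected (verts x l ∪ verts x' l')
    ((edges x l ++ edges x' l').toFinset.erase e₀) fun f hf => by
      have h1 : ∀ e ∈ edges x l ++ edges x' l', e ≠ e₀ → coboundary f e = 0 := fun e he hne =>
        hf e (Finset.mem_erase.2 ⟨hne, List.mem_toFinset.2 he⟩)
      have h2 := coboundary_eq_zero_of_odd f x l hl e₀ h₀
        fun e he => h1 e (List.mem_append_left _ he)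
      have h3 : ∀ e ∈ edges x l ++ edges x' l', coboundary f e = 0 := fun e he => by
        by_cases hne : e = e₀
        · rw [hne, h2]
        · exact h1 e he hne
      have h := eq_of_coboundary_edges f x l fun e he => h3 e (by simp [he])
      have h' := eq_of_coboundary_edges f x' l' fun e he => h3 e (by simp [he])
      have key : ∀ y ∈ verts x l ∪ verts x' l', f y = f w := by
        intro y hy
        rcases Finset.mem_union.1 hy with hy | hy
        · rw [h y hy, h w hw]
        · rw [h' y hy, h' w hw']
      intro y hy z hz
      rw [key y hy, key z hz]
  rw [Finset.card_erase_of_mem hmem] at this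
  have := Finset.card_pos.2 ⟨e₀, hmem⟩
  omega

/-- A walk is a double tree walk if it traverses all its edges at least twice and visits the maximal
possible number of vertices. -/
def IsDoubleTree (x : V) (l : List V) : Prop :=
  (∀ e ∈ edges x l, 2 ≤ (edges x l).count e) ∧ l.length + 2 ≤ 2 * (verts x l).card

theorem singles_eq_zero {L : List (Sym2 V)} (h : ∀ e ∈ L, 2 ≤ L.count e) : singles L = 0 := by
  rw [singles, Finset.card_eq_zero, Finset.filter_eq_empty_iff]
  intro e he
  have := h e (List.mem_toFinset.1 he)
  omega

theorem two_le_count_of_singles_eq_zero {L : List (Sym2 V)} (h : singles L = 0) :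
    ∀ e ∈ L, 2 ≤ L.count e := by
  intro e he
  rw [singles, Finset.card_eq_zero, Finset.filter_eq_empty_iff] at h
  have h1 := h (List.mem_toFinset.2 he)
  have h2 := List.count_pos_iff.2 he
  omega

/-- If twice the number of edges is the length, and no edge is single, then all edges are double. -/
theorem count_eq_two_of_card {L : List (Sym2 V)} (h : ∀ e ∈ L, 2 ≤ L.count e)
    (hc : L.length ≤ 2 * L.toFinset.card) : ∀ e ∈ L, L.count e = 2 := by
  have h1 : L.length = ∑ e ∈ L.toFinset, L.count e := (List.sum_toFinset_count_eq_length L).symm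
  have h2 : ∑ e ∈ L.toFinset, 2 = ∑ e ∈ L.toFinset, L.count e := by
    refine le_antisymm (Finset.sum_le_sum fun e he => h e (List.mem_toFinset.1 he)) ?_
    rw [← h1, Finset.sum_const, smul_eq_mul, mul_comm]
    exact hc
  have h3 := (Finset.sum_eq_sum_iff_of_le fun e he => h e (List.mem_toFinset.1 he)).1 h2
  exact fun e he => (h3 e (List.mem_toFinset.2 he)).symm

/-- Without single edges `2|E|` is at most the length, while connectedness gives `|V| ≤ |E| + 1`;
the lower bound on `|V|` forces equality in both. -/
theorem IsDoubleTree.two_mul_card_edges {x : V} {l : List V} (h : IsDoubleTree x l) :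
    2 * (edges x l).toFinset.card = l.length := by
  have h1 := two_mul_card_toFinset_le (L := edges x l)
  rw [singles_eq_zero h.1, edges_length] at h1
  have h2 := card_verts_le x l
  have h3 := h.2
  omega

theorem IsDoubleTree.two_mul_card_verts {x : V} {l : List V} (h : IsDoubleTree x l) :
    2 * (verts x l).card = l.length + 2 := by
  have h1 := h.two_mul_card_edges
  have h2 := card_verts_le x l
  have h3 := h.2
  omega

theorem IsDoubleTree.count_eq_two {x : V} {l : List V} (h : IsDoubleTree x l) :
    ∀ e ∈ edges x l, (edges x l).count e = 2 :=
  count_eq_two_of_card h.1 (by rw [h.two_mul_card_edges, edges_length])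

/-- Two double tree walks with a common edge. -/
theorem IsDoubleTree.card_union_le {x : V} {l : List V} {x' : V} {l' : List V} {k : ℕ}
    (h : IsDoubleTree x l) (h' : IsDoubleTree x' l') (hk : l.length = k) (hk' : l'.length = k)
    (hm : ¬ Disjoint (edges x l).toFinset (edges x' l').toFinset) :
    (verts x l ∪ verts x' l').card ≤ k := by
  have hv : ¬ Disjoint (verts x l) (verts x' l') := by
    obtain ⟨e, he, he'⟩ := Finset.not_disjoint_iff.1 hm
    induction e with
    | _ p q =>
      exact Finset.not_disjoint_iff.2 ⟨p, mem_verts_of_mem_edges (List.mem_toFinset.1 he) (by simp),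
        mem_verts_of_mem_edges (List.mem_toFinset.1 he') (by simp)⟩
  -- The union graph is connected and has at most `k/2 + k/2 - 1` edges, since one is shared.
  have h1 := card_union_verts_le x l x' l' hv
  rw [List.toFinset_append] at h1
  have h2 := Finset.card_union_add_card_inter (edges x l).toFinset (edges x' l').toFinset
  have h3 := Finset.card_pos.2 (Finset.not_disjoint_iff_nonempty_inter.1 hm)
  have h4 := h.two_mul_card_edges
  have h5 := h'.two_mul_card_edges
  omega

/-- If some edge is traversed an odd number of times, `|V| ≤ |E|` suffices. Otherwise there are no
single edges and the length is even, so failing the double tree condition costs two by parity. -/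
theorem two_mul_card_verts_le {x : V} {l : List V} (hl : endpoint x l = x)
    (h : ¬ IsDoubleTree x l) : 2 * (verts x l).card ≤ l.length + singles (edges x l) := by
  have h1 := two_mul_card_toFinset_le (L := edges x l)
  rw [edges_length] at h1
  by_cases ho : ∃ e, Odd ((edges x l).count e)
  · obtain ⟨e, he⟩ := ho
    have := card_verts_le_of_odd x l hl e he
    omega
  · have hs : singles (edges x l) = 0 := by
      by_contra hs
      exact ho (odd_of_singles_pos (Nat.pos_of_ne_zero hs))
    have hlen : ¬ Odd l.length := fun hodd =>
      ho (exists_odd_count_of_odd_length (by rwa [edges_length]))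
    have h2 : ¬ l.length + 2 ≤ 2 * (verts x l).card := fun hc =>
      h ⟨two_le_count_of_singles_eq_zero hs, hc⟩
    rw [Nat.not_odd_iff_even] at hlen
    obtain ⟨m, hm⟩ := hlen
    omega

theorem count_edges_eq_zero_of_disjoint {x : V} {l : List V} {x' : V} {l' : List V}
    (hd : Disjoint (verts x l) (verts x' l')) {e : Sym2 V} (he : e ∈ edges x l) :
    (edges x' l').count e = 0 := by
  refine List.count_eq_zero_of_not_mem fun he' => ?_
  induction e with
  | _ p q =>
    exact Finset.disjoint_left.1 hd (mem_verts_of_mem_edges he (Sym2.mem_mk_left p q))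
      (mem_verts_of_mem_edges he' (Sym2.mem_mk_left p q))

theorem singles_append_of_disjoint {x : V} {l : List V} {x' : V} {l' : List V}
    (hd : Disjoint (verts x l) (verts x' l')) :
    singles (edges x l) + singles (edges x' l') ≤ singles (edges x l ++ edges x' l') := by
  rw [singles, singles, singles, ← Finset.card_union_of_disjoint]
  · refine Finset.card_le_card fun e he => ?_
    simp only [Finset.mem_union, Finset.mem_filter, List.mem_toFinset, List.mem_append,
      List.count_append] at he ⊢
    rcases he with ⟨h1, h2⟩ | ⟨h1, h2⟩
    · exact ⟨Or.inl h1, by rw [h2, count_edges_eq_zero_of_disjoint hd h1]⟩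
    · exact ⟨Or.inr h1, by rw [h2, count_edges_eq_zero_of_disjoint hd.symm h1]⟩
  · refine Finset.disjoint_left.2 fun e he he' => ?_
    simp only [Finset.mem_filter, List.mem_toFinset] at he he'
    have := count_edges_eq_zero_of_disjoint hd he.1
    omega

/-- The fundamental inequality for pairs of closed walks that are not double tree walks. -/
theorem two_mul_card_union_verts_le {x : V} {l : List V} {x' : V} {l' : List V} {k : ℕ}
    (hl : endpoint x l = x) (hl' : endpoint x' l' = x') (hk : l.length = k) (hk' : l'.length = k)
    (h : ¬ IsDoubleTree x l) (h' : ¬ IsDoubleTree x' l') :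
    2 * (verts x l ∪ verts x' l').card ≤ 2 * k + singles (edges x l ++ edges x' l') := by
  have hu := Finset.card_union_add_card_inter (verts x l) (verts x' l')
  by_cases hd : Disjoint (verts x l) (verts x' l')
  · have h1 := two_mul_card_verts_le hl h
    have h2 := two_mul_card_verts_le hl' h'
    have h3 := singles_append_of_disjoint hd
    omega
  have h1 := two_mul_card_toFinset_le (L := edges x l ++ edges x' l')
  rw [List.length_append, edges_length, edges_length] at h1
  have hd' : ¬ Disjoint (verts x' l') (verts x l) := fun hh => hd hh.symm
  by_cases ho : ∃ e, Odd ((edges x l).count e)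
  · obtain ⟨e, he⟩ := ho
    have := card_union_verts_le_of_odd x l x' l' hl hd e he
    omega
  by_cases ho' : ∃ e, Odd ((edges x' l').count e)
  · obtain ⟨e, he⟩ := ho'
    have := card_union_verts_le_of_odd x' l' x l hl' hd' e he
    rw [Finset.union_comm, List.toFinset_append, Finset.union_comm (edges x' l').toFinset,
      ← List.toFinset_append] at this
    omega
  -- With all multiplicities even in both walks there are no single edges anywhere, and the bounds
  -- for the separate walks can simply be added.
  have hs : singles (edges x l ++ edges x' l') = 0 := by
    by_contra hs
    obtain ⟨e, he⟩ := odd_of_singles_pos (Nat.pos_of_ne_zero hs)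
    rw [List.count_append] at he
    rcases Nat.even_or_odd ((edges x l).count e) with h2 | h2
    · exact ho' ⟨e, (Nat.odd_add'.1 he).2 h2⟩
    · exact ho ⟨e, h2⟩
  have hs1 : singles (edges x l) = 0 := by
    by_contra hs
    exact ho (odd_of_singles_pos (Nat.pos_of_ne_zero hs))
  have hs2 : singles (edges x' l') = 0 := by
    by_contra hs
    exact ho' (odd_of_singles_pos (Nat.pos_of_ne_zero hs))
  have h2 := two_mul_card_verts_le hl h
  have h3 := two_mul_card_verts_le hl' h'
  omega

end Walks

/-! ### Summation over lists of fixed length. -/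

section Lists

/-- The finite set of lists of length `k` over a finite type. -/
def listsOfLength (α : Type*) [Fintype α] [DecidableEq α] : ℕ → Finset (List α)
  | 0 => {[]}
  | k + 1 => (Finset.univ ×ˢ listsOfLength α k).image fun p => p.1 :: p.2

variable {α : Type*} [Fintype α] [DecidableEq α]

@[simp] theorem mem_listsOfLength {k : ℕ} {l : List α} :
    l ∈ listsOfLength α k ↔ l.length = k := by
  induction k generalizing l with
  | zero => simp [listsOfLength]
  | succ k ih => cases l <;> simp [listsOfLength, ih]

theorem sum_listsOfLength_succ {M : Type*} [AddCommMonoid M] (k : ℕ) (f : List α → M) :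
    ∑ l ∈ listsOfLength α (k + 1), f l = ∑ y, ∑ l ∈ listsOfLength α k, f (y :: l) := by
  rw [listsOfLength, Finset.sum_image, Finset.sum_product]
  rintro ⟨a, l⟩ - ⟨a', l'⟩ - h
  simpa using h

theorem card_listsOfLength (k : ℕ) : (listsOfLength α k).card = Fintype.card α ^ k := by
  induction k with
  | zero => simp [listsOfLength]
  | succ k ih =>
    rw [Finset.card_eq_sum_ones, sum_listsOfLength_succ]
    simp only [ih, Finset.sum_const, Finset.card_univ, smul_eq_mul, mul_one, pow_succ, mul_comm]

end Lists

/-! ### Coding double tree walks by words of push and pop operations. -/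

section Stack

variable {V : Type*}

/-- All steps of the walk follow the relation `rel`. -/
def IsRelWalk (rel : V → V → Prop) : V → List V → Prop
  | _, [] => True
  | x, y :: l => rel x y ∧ IsRelWalk rel y l

/-- The word `w` of push operations `some y` and pop operations `none` transforms the stack with
top `x` and remainder `st` into a stack with only one element, where only vertices related to the
top may be pushed. -/
def Accepts (rel : V → V → Prop) : V → List V → List (Option V) → Prop
  | _, st, [] => st = []
  | x, st, some y :: w => rel x y ∧ Accepts rel y (x :: st) w
  | _, [], none :: _ => False
  | _, z :: st, none :: w => Accepts rel z st w

/-- The successive top elements of the stack while the operations of a word are carried out. -/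
def tops : V → List V → List (Option V) → List V
  | _, _, [] => []
  | x, st, some y :: w => y :: tops y (x :: st) w
  -- A pop with nothing below the top is never accepted; this value only keeps the length of the
  -- walk equal to that of the word.
  | x, [], none :: w => x :: tops x [] w
  | _, z :: st, none :: w => z :: tops z st w

/-- The number of nonnegative lattice paths with `k` steps `±1` from height `h` to height `0`. -/
def pathCount : ℕ → ℕ → ℝ
  | 0, 0 => 1
  | 0, _ + 1 => 0
  | k + 1, 0 => pathCount k 1
  | k + 1, h + 1 => pathCount k (h + 2) + pathCount k h

@[simp] theorem tops_length (x : V) (st : List V) (w : List (Option V)) :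
    (tops x st w).length = w.length := by
  induction w generalizing x st with
  | nil => rfl
  | cons o w ih => rcases o with _ | y <;> rcases st with _ | ⟨z, st⟩ <;> simp [tops, ih]

/-- The bottom of the stack is never removed, and it is all that is left at the end. With an empty
remainder the walk is closed. -/
theorem endpoint_tops {rel : V → V → Prop} {x : V} {st : List V} {w : List (Option V)}
    (h : Accepts rel x st w) : endpoint x (tops x st w) = endpoint x st := by
  induction w generalizing x st with
  | nil =>
    rw [Accepts] at h
    rw [h, tops]
  | cons o w ih =>
    rcases o with _ | y
    · rcases st with _ | ⟨z, st⟩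
      · exact h.elim
      · exact ih (x := z) h
    · exact ih (x := y) h.2

theorem isRelWalk_tops {rel : V → V → Prop} (hrel : ∀ x y, rel x y → rel y x) {x : V} {st : List V}
    {w : List (Option V)} (h : Accepts rel x st w) (hst : IsRelWalk rel x st) :
    IsRelWalk rel x (tops x st w) := by
  induction w generalizing x st with
  | nil => trivial
  | cons o w ih =>
    rcases o with _ | y
    · rcases st with _ | ⟨z, st⟩
      · exact h.elim
      · exact ⟨hst.1, ih (x := z) h hst.2⟩
    · exact ⟨h.1, ih (x := y) h.2 ⟨hrel _ _ h.1, hst⟩⟩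

/-- An accepted word is determined by its pattern and the walk of the top elements. -/
theorem eq_of_map_isSome_of_tops {rel : V → V → Prop} {x : V} {st : List V}
    {w w' : List (Option V)} (h : Accepts rel x st w) (h' : Accepts rel x st w')
    (hm : w.map Option.isSome = w'.map Option.isSome) (ht : tops x st w = tops x st w') :
    w = w' := by
  induction w generalizing x st w' with
  | nil =>
    cases w' with
    | nil => rfl
    | cons => simp at hm
  | cons o w ih =>
    rcases w' with _ | ⟨o', w'⟩
    · simp at hm
    rcases o with _ | y <;> rcases o' with _ | y'
    · rcases st with _ | ⟨z, st⟩
      · exact h.elim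
      · simp only [List.map_cons, List.cons.injEq, true_and, tops] at hm ht
        rw [ih (x := z) h h' hm ht]
    · simp at hm
    · simp at hm
    · simp only [List.map_cons, List.cons.injEq, tops, Option.isSome_some, true_and] at hm ht
      obtain ⟨rfl, ht⟩ := ht
      rw [ih h.2 h'.2 hm ht]

variable [DecidableEq V]

/-- Each pushed edge is traversed backwards when it is popped. The edges of the initial stack are
the ones popped without having been pushed by the word, hence the second summand. -/
theorem even_count_edges_tops {rel : V → V → Prop} {x : V} {st : List V} {w : List (Option V)}
    (h : Accepts rel x st w) (e : Sym2 V) :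
    Even ((edges x (tops x st w)).count e + (edges x st).count e) := by
  induction w generalizing x st with
  | nil =>
    rw [Accepts] at h
    simp [h, tops, edges]
  | cons o w ih =>
    rcases o with _ | y
    · rcases st with _ | ⟨z, st⟩
      · exact h.elim
      · have h1 := ih (x := z) h
        simp only [tops, edges, List.count_cons]
        rw [Nat.even_iff] at h1 ⊢
        omega
    · have h1 := ih (x := y) h.2
      simp only [tops, edges, List.count_cons, Sym2.eq_swap (a := y) (b := x)] at h1 ⊢
      rw [Nat.even_iff] at h1 ⊢
      omega

/-- Only pushes can reach new vertices. As pops exceed pushes by `st.length`, there are `(w.length -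
st.length) / 2` pushes. -/
theorem card_union_tops_le {rel : V → V → Prop} {x : V} {st : List V} {w : List (Option V)}
    (h : Accepts rel x st w) (vis : Finset V) (hvis : ∀ v ∈ x :: st, v ∈ vis) :
    2 * (vis ∪ (tops x st w).toFinset).card + st.length ≤ 2 * vis.card + w.length := by
  induction w generalizing x st vis with
  | nil =>
    rw [Accepts] at h
    simp [h, tops]
  | cons o w ih =>
    rcases o with _ | y
    · rcases st with _ | ⟨z, st⟩
      · exact h.elim
      · have hz : z ∈ vis := hvis z (by simp)
        have h1 := ih (x := z) h vis fun v hv => hvis v (List.mem_cons_of_mem _ hv)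
        simp only [tops, List.toFinset_cons, List.length_cons, Finset.union_insert]
        rw [Finset.insert_eq_of_mem (Finset.mem_union_left _ hz)]
        omega
    · have h1 := ih (x := y) h.2 (insert y vis) (by
        intro v hv
        rcases List.mem_cons.1 hv with rfl | hv
        · simp
        · exact Finset.mem_insert_of_mem (hvis v hv))
      simp only [tops, List.toFinset_cons, List.length_cons, Finset.union_insert,
        Finset.insert_union] at h1 ⊢
      have := Finset.card_insert_le y vis
      omega

/-- Among the accepted words whose walk visits the maximal possible number of vertices, a word is
determined by the walk. -/
theorem eq_of_tops_eq {rel : V → V → Prop} {x : V} {st : List V} {w w' : List (Option V)}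
    (h : Accepts rel x st w) (h' : Accepts rel x st w') (ht : tops x st w = tops x st w')
    (vis : Finset V) (hvis : ∀ v ∈ x :: st, v ∈ vis)
    (hmax : 2 * vis.card + w.length ≤ 2 * (vis ∪ (tops x st w).toFinset).card + st.length) :
    w = w' := by
  induction w generalizing x st w' vis with
  | nil =>
    have := congrArg List.length ht
    simp only [tops_length, List.length_nil] at this
    exact (List.length_eq_zero_iff.1 this.symm).symm
  | cons o w ih =>
    rcases w' with _ | ⟨o', w'⟩
    · have := congrArg List.length ht
      simp at this
    -- By maximality every push must reach an unvisited vertex, whereas a pop returns to a visited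
    -- one. So the walk itself tells pushes from pops.
    have push_new : ∀ (y : V) (u : List (Option V)), u.length = w.length →
        Accepts rel x st (some y :: u) →
        2 * vis.card + w.length + 1 ≤
          2 * (vis ∪ (tops x st (some y :: u)).toFinset).card + st.length → y ∉ vis := by
      intro y u hu hacc hle hy
      have h1 := card_union_tops_le hacc.2 vis (by
        intro v hv
        rcases List.mem_cons.1 hv with rfl | hv
        · exact hy
        · exact hvis v hv)
      simp only [tops, List.toFinset_cons, Finset.union_insert, List.length_cons] at hle h1
      rw [Finset.insert_eq_of_mem (Finset.mem_union_left _ hy)] at hle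
      omega
    have hlen : w'.length = w.length := by
      have := congrArg List.length ht
      simp only [tops_length, List.length_cons] at this
      omega
    simp only [List.length_cons] at hmax
    rcases o with _ | y <;> rcases o' with _ | y'
    · rcases st with _ | ⟨z, st⟩
      · exact h.elim
      · have hz : z ∈ vis := hvis z (by simp)
        simp only [tops, List.cons.injEq, true_and] at ht
        rw [ih (x := z) h h' ht vis (fun v hv => hvis v (List.mem_cons_of_mem _ hv))]
        simp only [tops, List.toFinset_cons, List.length_cons, Finset.union_insert] at hmax
        rw [Finset.insert_eq_of_mem (Finset.mem_union_left _ hz)] at hmax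
        omega
    · rcases st with _ | ⟨z, st⟩
      · exact h.elim
      · have hy := push_new y' w' hlen h' (by rw [← ht]; omega)
        simp only [tops, List.cons.injEq] at ht
        exact (hy (ht.1 ▸ hvis z (by simp))).elim
    · rcases st with _ | ⟨z, st⟩
      · exact h'.elim
      · have hy := push_new y w rfl h (by omega)
        simp only [tops, List.cons.injEq] at ht
        exact (hy (ht.1 ▸ hvis z (by simp))).elim
    · have hy := push_new y w rfl h (by omega)
      simp only [tops, List.cons.injEq] at ht
      obtain ⟨rfl, ht⟩ := ht
      rw [ih h.2 h'.2 ht (insert y vis)]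
      · intro v hv
        rcases List.mem_cons.1 hv with rfl | hv
        · simp
        · exact Finset.mem_insert_of_mem (hvis v hv)
      · simp only [tops, List.toFinset_cons, List.length_cons, Finset.union_insert,
          Finset.insert_union] at hmax ⊢
        rw [Finset.card_insert_of_notMem hy]
        omega

open Classical in
/-- Every newly visited vertex of a walk comes with an edge that leaves the set of vertices visited
before. -/
theorem card_union_le_card_add_card_edges (vis : Finset V) (x : V) (l : List V) (hx : x ∈ vis) :
    (vis ∪ l.toFinset).card ≤
      vis.card + ((edges x l).toFinset.filter fun e => ¬ ∀ v ∈ e, v ∈ vis).card := by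
  induction l generalizing x vis with
  | nil => simp
  | cons y l ih =>
    by_cases hy : y ∈ vis
    · have h1 := ih vis y hy
      rw [List.toFinset_cons, Finset.union_insert,
        Finset.insert_eq_of_mem (Finset.mem_union_left _ hy)]
      refine h1.trans (Nat.add_le_add_left (Finset.card_le_card ?_) _)
      refine Finset.filter_subset_filter _ ?_
      simp only [edges, List.toFinset_cons]
      exact Finset.subset_insert _ _
    · have h1 := ih (insert y vis) y (by simp)
      rw [List.toFinset_cons, Finset.union_insert, ← Finset.insert_union]
      rw [Finset.card_insert_of_notMem hy] at h1
      have h2 : insert s(x, y)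
          ((edges y l).toFinset.filter fun e => ¬ ∀ v ∈ e, v ∈ insert y vis) ⊆
          (edges x (y :: l)).toFinset.filter fun e => ¬ ∀ v ∈ e, v ∈ vis := by
        intro e he
        simp only [edges, List.toFinset_cons, Finset.mem_filter, Finset.mem_insert] at he ⊢
        rcases he with rfl | ⟨h3, h4⟩
        · exact ⟨Or.inl rfl, fun hc => hy (hc y (by simp))⟩
        · exact ⟨Or.inr h3, fun hc => h4 fun v hv => Or.inr (hc v hv)⟩
      have h3 := Finset.card_le_card h2
      rw [Finset.card_insert_of_notMem] at h3
      · omega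
      · simp [hx]

theorem edges_nodup {x : V} {st : List V} (h : (x :: st).Nodup) : (edges x st).Nodup := by
  induction st generalizing x with
  | nil => simp [edges]
  | cons z st ih =>
    rw [List.nodup_cons] at h
    refine List.nodup_cons.2 ⟨fun he => h.1 ?_, ih h.2⟩
    have := mem_verts_of_mem_edges he (Sym2.mem_mk_left x z)
    simpa [verts] using this

/-- A walk all of whose edges are traversed twice (together with the path given by the stack) and
which visits as many new vertices as possible comes from an accepted word. -/
theorem exists_accepts_tops_eq {rel : V → V → Prop} (x : V) (st l : List V) (vis : Finset V)
    (hnd : (x :: st).Nodup) (hvis : ∀ v ∈ x :: st, v ∈ vis) (hrel : IsRelWalk rel x l)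
    (h2 : ∀ e ∈ edges x st ++ edges x l, 2 ≤ (edges x st ++ edges x l).count e)
    (hmax : 2 * vis.card + l.length ≤ 2 * (vis ∪ l.toFinset).card + st.length) :
    ∃ w, Accepts rel x st w ∧ tops x st w = l := by
  classical
  induction l generalizing x st vis with
  | nil =>
    refine ⟨[], ?_, rfl⟩
    rcases st with _ | ⟨z, st⟩
    · rfl
    -- If the walk is over while the stack path still has an edge, that edge was traversed only
    -- once.
    · have h3 := h2 s(x, z) (by simp [edges])
      have h4 := List.nodup_iff_count_le_one.1 (edges_nodup hnd) s(x, z)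
      simp only [edges, List.append_nil] at h3 h4
      omega
  | cons y l ih =>
    by_cases hy : y ∈ vis
    -- A step to a visited vertex must be a pop. The stack edges and the edges `F` leaving `vis` are
    -- disjoint, and by maximality together they already number half the length of `L`, the most
    -- possible without single edges. Hence `s(x, y)`, which lies inside `vis`, is a stack edge, and
    -- all multiplicities are exactly two; since the stack has no repetitions, `s(x, y)` is its top
    -- edge.
    · set L := edges x st ++ edges x (y :: l) with hL
      have hlen : L.length = st.length + (l.length + 1) := by simp [hL]
      have hLs := two_mul_card_toFinset_le (L := L)
      rw [singles_eq_zero h2, hlen] at hLs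
      have hdisc := card_union_le_card_add_card_edges vis x (y :: l) (hvis x (by simp))
      set F := (edges x (y :: l)).toFinset.filter fun e => ¬ ∀ v ∈ e, v ∈ vis
      have hstack : ∀ e ∈ edges x st, ∀ v ∈ e, v ∈ vis := fun e he v hv => by
        have := mem_verts_of_mem_edges he hv
        exact hvis v (by simpa [verts] using this)
      have hcard : (edges x st).toFinset.card = st.length := by
        rw [List.toFinset_card_of_nodup (edges_nodup hnd), edges_length]
      have hF : F ⊆ L.toFinset := by
        intro e he
        have := (Finset.mem_filter.1 he).1
        simp only [List.mem_toFinset] at this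
        simp [hL, this]
      have hS : (edges x st).toFinset ⊆ L.toFinset := by
        intro e he
        simp only [List.mem_toFinset] at he
        simp [hL, he]
      have hdisj : ∀ S : Finset (Sym2 V), (∀ e ∈ S, ∀ v ∈ e, v ∈ vis) → Disjoint S F := by
        intro S hS'
        exact Finset.disjoint_left.2 fun e he he' => (Finset.mem_filter.1 he').2 (hS' e he)
      have hmem : s(x, y) ∈ edges x st := by
        by_contra hmem
        have hsub : insert s(x, y) (edges x st).toFinset ∪ F ⊆ L.toFinset :=
          Finset.union_subset (Finset.insert_subset (by simp [hL, edges]) hS) hF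
        have hc := Finset.card_le_card hsub
        rw [Finset.card_union_of_disjoint (hdisj _ _),
          Finset.card_insert_of_notMem (by simpa using hmem), hcard] at hc
        · simp only [List.length_cons] at hmax
          omega
        · intro e he
          rcases Finset.mem_insert.1 he with rfl | he
          · intro v hv
            rcases Sym2.mem_iff.1 hv with rfl | rfl
            · exact hvis v (by simp)
            · exact hy
          · exact hstack e (List.mem_toFinset.1 he)
      have hc := Finset.card_le_card (Finset.union_subset hS hF)
      rw [Finset.card_union_of_disjoint
        (hdisj _ fun e he => hstack e (List.mem_toFinset.1 he)), hcard] at hc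
      simp only [List.length_cons] at hmax
      have htwo := count_eq_two_of_card h2 (by omega)
      rcases st with _ | ⟨z, st⟩
      · simp [edges] at hmem
      rw [List.nodup_cons] at hnd
      obtain rfl : y = z := by
        simp only [edges, List.mem_cons] at hmem
        rcases hmem with hmem | hmem
        · exact Sym2.congr_right.1 hmem
        · have := mem_verts_of_mem_edges hmem (Sym2.mem_mk_left x y)
          exact (hnd.1 (by simpa [verts] using this)).elim
      -- Popping removes both occurrences of the top edge, so the condition on multiplicities passes
      -- to the rest.
      have hcount : ∀ e, L.count e = (edges y st ++ edges y l).count e +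
          2 * (if s(x, y) == e then 1 else 0) := by
        intro e
        simp only [hL, edges, List.count_append, List.count_cons]
        omega
      obtain ⟨w, hw, hw'⟩ := ih y st vis hnd.2 (fun v hv => hvis v (List.mem_cons_of_mem _ hv))
        hrel.2 (fun e he => by
          have h3 := List.count_pos_iff.2 he
          have h4 := hcount e
          have h5 := htwo e (by
            simp only [List.mem_append, hL, edges, List.mem_cons] at he ⊢
            tauto)
          split_ifs at h4 <;> omega) (by
          rw [List.toFinset_cons, Finset.union_insert,
            Finset.insert_eq_of_mem (Finset.mem_union_left _ hy)] at hmax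
          simp only [List.length_cons] at hmax
          omega)
      exact ⟨none :: w, hw, by rw [tops, hw']⟩
    -- A step to a new vertex is a push: the edge moves from the walk to the stack path and the
    -- multiset of edges is unchanged.
    · have hperm : (edges y (x :: st) ++ edges y l).Perm (edges x st ++ edges x (y :: l)) := by
        simp only [edges, Sym2.eq_swap (a := y) (b := x), List.cons_append]
        exact List.perm_middle.symm
      obtain ⟨w, hw, hw'⟩ := ih y (x :: st) (insert y vis)
        (List.nodup_cons.2 ⟨fun hc => hy (hvis y hc), hnd⟩)
        (fun v hv => by
          rcases List.mem_cons.1 hv with rfl | hv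
          · simp
          · exact Finset.mem_insert_of_mem (hvis v hv)) hrel.2
        (fun e he => by
          rw [hperm.count_eq]
          exact h2 e (hperm.mem_iff.1 he)) (by
          rw [List.toFinset_cons, Finset.union_insert, ← Finset.insert_union] at hmax
          rw [Finset.card_insert_of_notMem hy]
          simp only [List.length_cons] at hmax ⊢
          omega)
      exact ⟨some y :: w, ⟨hrel.1, hw⟩, by rw [tops, hw']⟩

variable [Fintype V]

open Classical in
/-- The number of accepted words in a regular graph. -/
theorem card_accepts (rel : V → V → Prop) (b : ℕ)
    (hreg : ∀ x, (Finset.univ.filter fun y => rel x y).card = b) (k : ℕ) (x : V) (st : List V) :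
    √(b : ℝ) ^ st.length * (((listsOfLength (Option V) k).filter (Accepts rel x st)).card : ℝ) =
      √(b : ℝ) ^ k * pathCount k st.length := by
  -- Each of the `(k - st.length) / 2` pushes of an accepted word has `b` choices, so every lattice
  -- path is realized by `√b ^ (k - st.length)` words. The power of `√b` on the left avoids
  -- subtraction in the exponent.
  induction k generalizing x st with
  | zero =>
    rcases st with _ | ⟨z, st⟩ <;>
      simp [listsOfLength, pathCount, Accepts, Finset.filter_singleton]
  | succ k ih =>
    have hb : √(b : ℝ) * √(b : ℝ) = b := Real.mul_self_sqrt (Nat.cast_nonneg b)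
    have hpush : ∑ y : V, ∑ w ∈ listsOfLength (Option V) k,
        (if Accepts rel x st (some y :: w) then 1 else 0 : ℝ) * √(b : ℝ) ^ (st.length + 1) =
        b * (√(b : ℝ) ^ k * pathCount k (st.length + 1)) := by
      have : ∀ y : V, ∑ w ∈ listsOfLength (Option V) k,
          (if Accepts rel x st (some y :: w) then 1 else 0 : ℝ) * √(b : ℝ) ^ (st.length + 1) =
          if rel x y then √(b : ℝ) ^ k * pathCount k (st.length + 1) else 0 := by
        intro y
        split_ifs with hxy
        · rw [← Finset.sum_mul, mul_comm, ← List.length_cons (a := x), ← ih y (x :: st)]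
          simp [Accepts, hxy]
        · simp [Accepts, hxy]
      simp only [this, ← Finset.sum_filter, Finset.sum_const, hreg, nsmul_eq_mul]
    rw [Finset.card_filter, Nat.cast_sum, sum_listsOfLength_succ, Fintype.sum_option]
    simp only [← Finset.sum_mul] at hpush
    push_cast
    rcases st with _ | ⟨z, st⟩
    · simp only [List.length_nil, zero_add, pow_one, pow_zero, one_mul, pathCount] at hpush ⊢
      have e0 : ∀ w, ¬ Accepts rel x [] (none :: w) := fun w h => h
      simp only [e0, if_false, Finset.sum_const_zero, zero_add]
      -- The push identity carries an extra factor `√b`, which can be cancelled only for positive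
      -- `b`; for `b = 0` no push is possible.
      rcases Nat.eq_zero_or_pos b with rfl | hbpos
      · have : ∀ y, ¬ rel x y := by
          intro y hy
          have := hreg x
          rw [Finset.card_eq_zero, Finset.filter_eq_empty_iff] at this
          exact this (Finset.mem_univ y) hy
        simp [this, Accepts]
      · have h0 : √(b : ℝ) ≠ 0 := (Real.sqrt_pos.2 (Nat.cast_pos.2 hbpos)).ne'
        refine mul_right_cancel₀ h0 ?_
        linear_combination hpush - √(b : ℝ) ^ k * pathCount k 1 * hb
    · have hpop := ih z st
      rw [Finset.card_filter, Nat.cast_sum] at hpop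
      push_cast at hpop
      simp only [List.length_cons, pathCount] at hpush ⊢
      have e1 : ∀ w, Accepts rel x (z :: st) (none :: w) ↔ Accepts rel z st w := fun w => Iff.rfl
      simp only [e1]
      rcases Nat.eq_zero_or_pos b with rfl | hbpos
      · simp
      · have h0 : √(b : ℝ) ≠ 0 := (Real.sqrt_pos.2 (Nat.cast_pos.2 hbpos)).ne'
        refine mul_right_cancel₀ h0 ?_
        linear_combination hpush + √(b : ℝ) * √(b : ℝ) * hpop -
          √(b : ℝ) ^ k * pathCount k (st.length + 2) * hb

open Classical in
/-- The closed walks of length `k` that follow the relation `rel`, as pairs of the starting point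
and the list of the other vertices. -/
noncomputable def closedWalks (rel : V → V → Prop) (k : ℕ) : Finset (V × List V) :=
  (Finset.univ ×ˢ listsOfLength V k).filter fun p => endpoint p.1 p.2 = p.1 ∧ IsRelWalk rel p.1 p.2

open Classical in
/-- The closed double tree walks of length `k` that follow the relation `rel`. -/
noncomputable def treeWalks (rel : V → V → Prop) (k : ℕ) : Finset (V × List V) :=
  (closedWalks rel k).filter fun p => IsDoubleTree p.1 p.2

open Classical in
/-- The accepted words of length `k`, together with the initial element of the stack. -/
noncomputable def stackWords (rel : V → V → Prop) (k : ℕ) : Finset (V × List (Option V)) :=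
  (Finset.univ ×ˢ listsOfLength (Option V) k).filter fun p => Accepts rel p.1 [] p.2

open Classical in
theorem card_stackWords (rel : V → V → Prop) (b : ℕ)
    (hreg : ∀ x, (Finset.univ.filter fun y => rel x y).card = b) (k : ℕ) :
    ((stackWords rel k).card : ℝ) = Fintype.card V * (√(b : ℝ) ^ k * pathCount k 0) := by
  classical
  rw [stackWords, Finset.card_filter, Finset.sum_product, Nat.cast_sum]
  have h : ∀ x : V, ((∑ w ∈ listsOfLength (Option V) k,
      if Accepts rel x [] w then 1 else 0 : ℕ) : ℝ) = √(b : ℝ) ^ k * pathCount k 0 := by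
    intro x
    have := card_accepts rel b hreg k x []
    rw [← Finset.card_filter]
    simpa using this
  simp only [h, Finset.sum_const, Finset.card_univ, nsmul_eq_mul]

/-- By `exists_accepts_tops_eq` every double tree walk is the walk of top elements of some accepted
word. -/
theorem card_treeWalks_le (rel : V → V → Prop) (k : ℕ) :
    (treeWalks rel k).card ≤ (stackWords rel k).card := by
  classical
  refine (Finset.card_le_card (t := (stackWords rel k).image fun p => (p.1, tops p.1 [] p.2))
    fun p hp => ?_).trans Finset.card_image_le
  obtain ⟨x, l⟩ := p
  simp only [treeWalks, closedWalks, Finset.mem_filter, Finset.mem_product, Finset.mem_univ,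
    true_and, mem_listsOfLength] at hp
  obtain ⟨⟨hlen, -, hrel⟩, ht⟩ := hp
  obtain ⟨w, hw, hw'⟩ := exists_accepts_tops_eq x [] l {x} (by simp) (by simp) hrel
    (by simpa [edges] using ht.1) (by
      have := ht.2
      rw [verts, Finset.insert_eq] at this
      simp only [Finset.card_singleton, List.length_nil]
      omega)
  refine Finset.mem_image.2 ⟨(x, w), ?_, by simp [hw']⟩
  simp only [stackWords, Finset.mem_filter, Finset.mem_product, Finset.mem_univ, true_and,
    mem_listsOfLength]
  exact ⟨by rw [← hlen, ← hw', tops_length], hw⟩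

/-- Words whose walk visits more than `k/2` vertices correspond injectively to double tree walks.
Any other word is recovered from its walk together with its push and pop pattern, one of `2 ^ k`. -/
theorem card_stackWords_le (rel : V → V → Prop) (hrel : ∀ x y, rel x y → rel y x) (k : ℕ) :
    (stackWords rel k).card ≤ (treeWalks rel k).card +
      2 ^ k * ((Finset.univ ×ˢ listsOfLength V k).filter
        fun p => 2 * (verts p.1 p.2).card ≤ k).card := by
  classical
  have hmemw : ∀ p : V × List (Option V), p ∈ stackWords rel k ↔
      p.2.length = k ∧ Accepts rel p.1 [] p.2 := by
    intro p
    simp [stackWords]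
  rw [← Finset.card_filter_add_card_filter_not
    (fun p : V × List (Option V) => 2 * (verts p.1 (tops p.1 [] p.2)).card ≤ k), add_comm]
  refine Nat.add_le_add ?_ ?_
  · refine Finset.card_le_card_of_injOn (fun p => (p.1, tops p.1 [] p.2)) ?_ ?_
    · rintro ⟨x, w⟩ hp
      simp only [Finset.coe_filter, Set.mem_ofPred_eq, hmemw] at hp
      obtain ⟨⟨hlen, hacc⟩, hv⟩ := hp
      simp only [treeWalks, closedWalks, Finset.coe_filter, Finset.mem_filter, Finset.mem_product,
        Finset.mem_univ, true_and, mem_listsOfLength, Set.mem_ofPred_eq, tops_length]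
      have heven : ∀ e, Even ((edges x (tops x [] w)).count e) := fun e => by
        simpa [edges] using even_count_edges_tops hacc e
      refine ⟨⟨hlen, endpoint_tops hacc, isRelWalk_tops hrel hacc trivial⟩, fun e he => ?_, ?_⟩
      · have h1 := List.count_pos_iff.2 he
        obtain ⟨m, hm⟩ := heven e
        omega
      -- Evenness of `k` improves `2|V| > k` to `2|V| ≥ k + 2`.
      · have hk : Even (edges x (tops x [] w)).length := by
          by_contra hodd
          obtain ⟨e, he⟩ := exists_odd_count_of_odd_length (Nat.not_even_iff_odd.1 hodd)
          exact (Nat.not_even_iff_odd.2 he) (heven e)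
        rw [edges_length, tops_length] at hk
        obtain ⟨m, hm⟩ := hk
        rw [tops_length]
        omega
    · rintro ⟨x, w⟩ hp ⟨x', w'⟩ hp' heq
      simp only [Finset.coe_filter, Set.mem_ofPred_eq, hmemw] at hp hp'
      simp only [Prod.mk.injEq] at heq
      obtain ⟨rfl, heq⟩ := heq
      refine Prod.ext rfl (eq_of_tops_eq hp.1.2 hp'.1.2 heq {x} (by simp) ?_)
      have h1 := hp.2
      have h2 := hp.1.1
      rw [verts, Finset.insert_eq] at h1
      have hk : Even w.length := by
        by_contra hodd
        obtain ⟨e, he⟩ := exists_odd_count_of_odd_length (L := edges x (tops x [] w))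
          (by rw [edges_length, tops_length]; exact Nat.not_even_iff_odd.1 hodd)
        refine (Nat.not_even_iff_odd.2 he) ?_
        simpa [edges] using even_count_edges_tops hp.1.2 e
      obtain ⟨m, hm⟩ := hk
      simp only [Finset.card_singleton, List.length_nil]
      omega
  · have hc : (listsOfLength Bool k).card = 2 ^ k := by rw [card_listsOfLength, Fintype.card_bool]
    rw [← hc, ← Finset.card_product]
    refine Finset.card_le_card_of_injOn
      (fun p => (p.2.map Option.isSome, (p.1, tops p.1 [] p.2))) ?_ ?_
    · rintro ⟨x, w⟩ hp
      simp only [Finset.coe_filter, Set.mem_ofPred_eq, hmemw] at hp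
      simp only [Finset.coe_product, Set.mem_prod, Finset.mem_coe, mem_listsOfLength,
        List.length_map, Finset.mem_filter, Finset.mem_product, Finset.mem_univ, true_and,
        tops_length]
      exact ⟨hp.1.1, hp.1.1, hp.2⟩
    · rintro ⟨x, w⟩ hp ⟨x', w'⟩ hp' heq
      simp only [Finset.coe_filter, Set.mem_ofPred_eq, hmemw] at hp hp'
      simp only [Prod.mk.injEq] at heq
      obtain ⟨h1, rfl, h2⟩ := heq
      exact Prod.ext rfl (eq_of_map_isSome_of_tops hp.1.2 hp'.1.2 h1 h2)

end Stack

/-! ### Counting walks by the number of vertices they visit. -/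

section Counting

variable {V : Type*} [Fintype V] [DecidableEq V] [Nonempty V]

/-- Each further vertex is either one already seen, with boundedly many choices, or new, with at
most `N` choices that the extra factor `1/N` compensates. So each step costs a factor independent of
`N`. -/
theorem sum_lists_inv_pow_card_le (k : ℕ) (S : Finset V) :
    ∑ l ∈ listsOfLength V k, ((Fintype.card V : ℝ) ^ (S ∪ l.toFinset).card)⁻¹ ≤
      ((S.card : ℝ) + k) ^ k * ((Fintype.card V : ℝ) ^ S.card)⁻¹ := by
  have hN : (0 : ℝ) < Fintype.card V := Nat.cast_pos.2 Fintype.card_pos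
  induction k generalizing S with
  | zero => simp [listsOfLength]
  | succ k ih =>
    rw [sum_listsOfLength_succ]
    set q : ℝ := ((Fintype.card V : ℝ) ^ S.card)⁻¹ with hq
    have hq0 : 0 ≤ q := by positivity
    set B : ℝ := ((S.card : ℝ) + k + 1) ^ k with hB
    have hB0 : 0 ≤ B := by positivity
    have h1 : ∀ y ∈ S, ∑ l ∈ listsOfLength V k,
        ((Fintype.card V : ℝ) ^ (S ∪ (y :: l).toFinset).card)⁻¹ ≤ B * q := by
      intro y hy
      have e : ∀ l : List V, S ∪ (y :: l).toFinset = S ∪ l.toFinset := fun l => by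
        rw [List.toFinset_cons, Finset.union_insert,
          Finset.insert_eq_of_mem (Finset.mem_union_left _ hy)]
      simp only [e]
      refine (ih S).trans (mul_le_mul_of_nonneg_right ?_ hq0)
      rw [hB]
      exact pow_le_pow_left₀ (by positivity) (by linarith) k
    have h2 : ∀ y ∉ S, ∑ l ∈ listsOfLength V k,
        ((Fintype.card V : ℝ) ^ (S ∪ (y :: l).toFinset).card)⁻¹ ≤
          B * q * (Fintype.card V : ℝ)⁻¹ := by
      intro y hy
      have e : ∀ l : List V, S ∪ (y :: l).toFinset = insert y S ∪ l.toFinset := fun l => by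
        rw [List.toFinset_cons, Finset.union_insert, Finset.insert_union]
      simp only [e]
      refine (ih _).trans (le_of_eq ?_)
      rw [Finset.card_insert_of_notMem hy, hB, hq, pow_succ, mul_inv]
      push_cast
      ring
    have h3 : ∑ y : V, ∑ l ∈ listsOfLength V k,
        ((Fintype.card V : ℝ) ^ (S ∪ (y :: l).toFinset).card)⁻¹ ≤
        ∑ y : V, ((if y ∈ S then B * q else 0) + B * q * (Fintype.card V : ℝ)⁻¹) := by
      refine Finset.sum_le_sum fun y _ => ?_
      by_cases hy : y ∈ S
      · rw [if_pos hy]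
        exact (h1 y hy).trans (le_add_of_nonneg_right (by positivity))
      · rw [if_neg hy, zero_add]
        exact h2 y hy
    refine h3.trans ?_
    rw [Finset.sum_add_distrib, ← Finset.sum_filter, Finset.sum_const, Finset.sum_const,
      Finset.filter_mem_eq_inter, Finset.univ_inter, Finset.card_univ, nsmul_eq_mul, nsmul_eq_mul]
    have e : (Fintype.card V : ℝ) * (B * q * (Fintype.card V : ℝ)⁻¹) = B * q := by
      field_simp
    rw [e, pow_succ]
    push_cast
    rw [← add_assoc, ← hB]
    have hk : (0 : ℝ) ≤ k := Nat.cast_nonneg k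
    nlinarith [mul_nonneg (mul_nonneg hB0 hq0) hk]

theorem sum_walks_inv_pow_card_le (k : ℕ) (S : Finset V) :
    ∑ p ∈ Finset.univ ×ˢ listsOfLength V k,
      ((Fintype.card V : ℝ) ^ (S ∪ verts p.1 p.2).card)⁻¹ ≤
      ((S.card : ℝ) + k + 1) ^ (k + 1) * ((Fintype.card V : ℝ) ^ S.card)⁻¹ := by
  have h := sum_lists_inv_pow_card_le (k + 1) S
  rw [sum_listsOfLength_succ] at h
  rw [Finset.sum_product]
  push_cast at h
  simpa only [verts, ← List.toFinset_cons, ← add_assoc] using h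

/-- The sum over all walks of length `k` is bounded independently of the number of vertices. -/
theorem sum_walks_inv_pow_card_verts_le (k : ℕ) :
    ∑ p ∈ Finset.univ ×ˢ listsOfLength V k, ((Fintype.card V : ℝ) ^ (verts p.1 p.2).card)⁻¹ ≤
      ((k : ℝ) + 1) ^ (k + 1) := by
  simpa using sum_walks_inv_pow_card_le (V := V) k ∅

/-- The sum over all pairs of walks of length `k` is bounded independently of the number of
vertices. -/
theorem sum_pairs_inv_pow_card_verts_le (k : ℕ) :
    ∑ p ∈ Finset.univ ×ˢ listsOfLength V k, ∑ p' ∈ Finset.univ ×ˢ listsOfLength V k,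
      ((Fintype.card V : ℝ) ^ (verts p.1 p.2 ∪ verts p'.1 p'.2).card)⁻¹ ≤
      ((k + 1 : ℝ) + k + 1) ^ (k + 1) * ((k : ℝ) + 1) ^ (k + 1) := by
  have h : ∀ p ∈ Finset.univ ×ˢ listsOfLength V k, ∑ p' ∈ Finset.univ ×ˢ listsOfLength V k,
      ((Fintype.card V : ℝ) ^ (verts p.1 p.2 ∪ verts p'.1 p'.2).card)⁻¹ ≤
      ((k + 1 : ℝ) + k + 1) ^ (k + 1) * ((Fintype.card V : ℝ) ^ (verts p.1 p.2).card)⁻¹ := by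
    intro p hp
    refine (sum_walks_inv_pow_card_le k (verts p.1 p.2)).trans ?_
    have hc : (verts p.1 p.2).card ≤ k + 1 := by
      have h1 := Finset.card_insert_le p.1 p.2.toFinset
      have h2 := List.toFinset_card_le p.2
      have h3 := mem_listsOfLength.1 (Finset.mem_product.1 hp).2
      rw [verts]
      omega
    have hc' : ((verts p.1 p.2).card : ℝ) ≤ k + 1 := by exact_mod_cast hc
    gcongr
  refine (Finset.sum_le_sum h).trans ?_
  rw [← Finset.mul_sum]
  gcongr
  exact sum_walks_inv_pow_card_verts_le k

/-- Markov's inequality for the weighted sum: each walk in `T` has weight at least `√N ^ (-m)`. -/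
theorem card_walks_le (k m : ℕ) (T : Finset (V × List V))
    (hT : ∀ p ∈ T, p.2.length = k ∧ 2 * (verts p.1 p.2).card ≤ m) :
    (T.card : ℝ) ≤ ((k : ℝ) + 1) ^ (k + 1) * √(Fintype.card V : ℝ) ^ m := by
  have hN : (1 : ℝ) ≤ Fintype.card V := by exact_mod_cast Fintype.card_pos (α := V)
  have hs : (1 : ℝ) ≤ √(Fintype.card V : ℝ) := Real.one_le_sqrt.2 hN
  have hsub : T ⊆ Finset.univ ×ˢ listsOfLength V k := fun p hp => by
    simp [(hT p hp).1]
  have h1 : ∑ p ∈ T, (√(Fintype.card V : ℝ) ^ m)⁻¹ ≤ ((k : ℝ) + 1) ^ (k + 1) := by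
    refine le_trans ?_ (sum_walks_inv_pow_card_verts_le (V := V) k)
    refine le_trans ?_ (Finset.sum_le_sum_of_subset_of_nonneg hsub fun p _ _ => by positivity)
    refine Finset.sum_le_sum fun p hp => ?_
    refine inv_anti₀ (by positivity) ?_
    have : (Fintype.card V : ℝ) = √(Fintype.card V : ℝ) ^ 2 := (Real.sq_sqrt (by positivity)).symm
    nth_rw 1 [this]
    rw [← pow_mul]
    exact pow_le_pow_right₀ hs (hT p hp).2
  rw [Finset.sum_const, nsmul_eq_mul] at h1
  exact (mul_inv_le_iff₀ (by positivity)).1 h1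

open Classical in
/-- The number of closed double tree walks in a regular graph. -/
theorem abs_card_treeWalks_sub_le (rel : V → V → Prop) (hrel : ∀ x y, rel x y → rel y x) (b : ℕ)
    (hreg : ∀ x, (Finset.univ.filter fun y => rel x y).card = b) (k : ℕ) :
    |((treeWalks rel k).card : ℝ) - Fintype.card V * (√(b : ℝ) ^ k * pathCount k 0)| ≤
      2 ^ k * (((k : ℝ) + 1) ^ (k + 1) * √(Fintype.card V : ℝ) ^ k) := by
  have h1 := card_treeWalks_le rel k
  have h2 := card_stackWords_le rel hrel k
  have h3 := card_walks_le k k ((Finset.univ ×ˢ listsOfLength V k).filter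
    fun p => 2 * (verts p.1 p.2).card ≤ k) fun p hp => by simpa using hp
  have h4 : ((stackWords rel k).card : ℝ) ≤ (treeWalks rel k).card +
      2 ^ k * (((Finset.univ ×ˢ listsOfLength V k).filter
        fun p => 2 * (verts p.1 p.2).card ≤ k).card : ℝ) := by exact_mod_cast h2
  have h5 : ((treeWalks rel k).card : ℝ) ≤ (stackWords rel k).card := by exact_mod_cast h1
  rw [← card_stackWords rel b hreg k, abs_le]
  have h6 : (2 : ℝ) ^ k * (((Finset.univ ×ˢ listsOfLength V k).filter
        fun p => 2 * (verts p.1 p.2).card ≤ k).card : ℝ) ≤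
      2 ^ k * (((k : ℝ) + 1) ^ (k + 1) * √(Fintype.card V : ℝ) ^ k) := by gcongr
  have h7 : (0 : ℝ) ≤ 2 ^ k * (((k : ℝ) + 1) ^ (k + 1) * √(Fintype.card V : ℝ) ^ k) := by
    positivity
  constructor <;> linarith

end Counting

/-! ### Regularity of the band. -/

section Relevant

open Classical in
/-- Every index has exactly `b` relevant neighbours. -/
theorem card_relevant {n b : ℕ} (hb : IsBandwidth n b) (i : Fin n) :
    (Finset.univ.filter fun j => Relevant b i j).card = b := by
  rcases hb with ⟨hlt, r, rfl⟩ | rfl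
  · have hn : 0 < n := i.pos
    -- In integers: the cyclic distance of `i` and `j` is at most the half-width `r`.
    have hrel : ∀ j : Fin n, Relevant (2 * r + 1) i j ↔
        ((i : ℤ) - j ≤ r ∧ (j : ℤ) - i ≤ r) ∨ (n : ℤ) - r ≤ i - j ∨ (n : ℤ) - r ≤ j - i := by
      intro j
      have e : (((2 * r + 1 : ℕ) : ℝ) - 1) / 2 = r := by push_cast; ring
      rw [Relevant, e, abs_le, le_abs]
      constructor
      · rintro (h | ⟨h1, h2⟩ | h | h)
        · omega
        · exact Or.inl ⟨by exact_mod_cast h2, by exact_mod_cast (by linarith : (j : ℝ) - i ≤ r)⟩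
        · exact Or.inr (Or.inl (by exact_mod_cast h))
        · exact Or.inr (Or.inr (by exact_mod_cast (by linarith : (n : ℝ) - r ≤ j - i)))
      · rintro (⟨h1, h2⟩ | h | h)
        · have h1' : (i : ℝ) - j ≤ r := by exact_mod_cast h1
          have h2' : (j : ℝ) - i ≤ r := by exact_mod_cast h2
          exact Or.inr (Or.inl ⟨by linarith, h1'⟩)
        · exact Or.inr (Or.inr (Or.inl (by exact_mod_cast h)))
        · have h' : (n : ℝ) - r ≤ j - i := by exact_mod_cast h
          exact Or.inr (Or.inr (Or.inr (by linarith)))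
    have hi := i.2
    refine Eq.trans (Eq.symm ?_) (Finset.card_range (2 * r + 1))
    -- The neighbours are `i - r + d` modulo `n` for `0 ≤ d ≤ 2r`; adding `n` prevents truncated
    -- subtraction, and `2r + 1 < n` makes them distinct.
    refine Finset.card_bij'
      (fun d _ => ⟨(i + n - r + d) % n, Nat.mod_lt _ hn⟩)
      (fun j _ => (j + n + r - i) % n) ?_ ?_ ?_ ?_
    · intro d hd
      rw [Finset.mem_range] at hd
      simp only [Finset.mem_filter, Finset.mem_univ, true_and, hrel]
      -- The number lies below `3n`, so reduction subtracts `0`, `n` or `2n`.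
      have hcases : (i + n - r + d) % n = i + n - r + d ∨
          (i + n - r + d) % n + n = i + n - r + d ∨
          (i + n - r + d) % n + 2 * n = i + n - r + d := by
        rcases Nat.lt_or_ge (i + n - r + d) n with h | h
        · exact Or.inl (Nat.mod_eq_of_lt h)
        · rcases Nat.lt_or_ge (i + n - r + d - n) n with h' | h'
          · right; left
            rw [Nat.mod_eq_sub_mod h, Nat.mod_eq_of_lt h']
            omega
          · right; right
            rw [Nat.mod_eq_sub_mod h, Nat.mod_eq_sub_mod h', Nat.mod_eq_of_lt (by omega)]
            omega
      have hlt' := Nat.mod_lt (i + n - r + d) hn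
      have hsub : (i : ℕ) + n - r + r = i + n := by omega
      generalize (i + n - r + d) % n = m at hcases hlt' ⊢
      generalize (i : ℕ) + n - r = u at hcases hsub
      omega
    · intro j hj
      simp only [Finset.mem_filter, Finset.mem_univ, true_and, hrel] at hj
      have hjn := j.2
      rw [Finset.mem_range]
      have hlt' := Nat.mod_lt (j + n + r - i) hn
      rcases Nat.lt_or_ge (j + n + r - i) n with h | h
      · rw [Nat.mod_eq_of_lt h]; omega
      · rcases Nat.lt_or_ge (j + n + r - i - n) n with h' | h'
        · rw [Nat.mod_eq_sub_mod h, Nat.mod_eq_of_lt h']; omega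
        · rw [Nat.mod_eq_sub_mod h, Nat.mod_eq_sub_mod h', Nat.mod_eq_of_lt (by omega)]
          omega
    · intro d hd
      rw [Finset.mem_range] at hd
      simp only
      have hlt' := Nat.mod_lt (i + n - r + d) hn
      have h1 : ((i + n - r + d) % n + n + r - i) % n = d % n := by
        have h2 := Nat.div_add_mod (i + n - r + d) n
        have h3 : (i + n - r + d) % n + n + r - i + n * ((i + n - r + d) / n) = d + n * 2 := by
          omega
        have h4 := congrArg (· % n) h3
        simpa [Nat.add_mul_mod_self_left] using h4
      rw [h1, Nat.mod_eq_of_lt (by omega)]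
    · intro j hj
      have hjn := j.2
      apply Fin.ext
      simp only
      have hlt' := Nat.mod_lt (j + n + r - i) hn
      have h2 := Nat.div_add_mod (j + n + r - i) n
      have h3 : i + n - r + (j + n + r - i) % n + n * ((j + n + r - i) / n) = j + n * 2 := by
        omega
      have h4 := congrArg (· % n) h3
      simp only [Nat.add_mul_mod_self_left] at h4
      rw [h4, Nat.mod_eq_of_lt hjn]
  · simp [Relevant]

end Relevant

/-! ### Traces of powers as sums over closed walks. -/

section Trace

variable {n : ℕ}

/-- A symmetric matrix as a function of unordered pairs. -/
def symEntry (A : Matrix (Fin n) (Fin n) ℝ) (hA : A.IsSymm) : Sym2 (Fin n) → ℝ :=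
  Sym2.lift ⟨fun i j => A i j, fun i j => (hA.apply i j).symm⟩

@[simp] theorem symEntry_mk (A : Matrix (Fin n) (Fin n) ℝ) (hA : A.IsSymm) (i j : Fin n) :
    symEntry A hA s(i, j) = A i j := rfl

/-- The product of the matrix entries along a walk. -/
def walkWeight (f : Sym2 (Fin n) → ℝ) (p : Fin n × List (Fin n)) : ℝ :=
  ((edges p.1 p.2).map f).prod

open Classical in
theorem band_pow_apply (b : ℕ) (A : Matrix (Fin n) (Fin n) ℝ) (hA : A.IsSymm) (k : ℕ)
    (x z : Fin n) :
    (band b A ^ k) x z = ∑ l ∈ listsOfLength (Fin n) k,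
      if endpoint x l = z ∧ IsRelWalk (Relevant b) x l then walkWeight (symEntry A hA) (x, l)
      else 0 := by
  induction k generalizing x with
  | zero =>
    simp [listsOfLength, endpoint, IsRelWalk, walkWeight, edges, Matrix.one_apply]
  | succ k ih =>
    rw [pow_succ', Matrix.mul_apply, sum_listsOfLength_succ]
    refine Finset.sum_congr rfl fun y _ => ?_
    rw [ih, Finset.mul_sum]
    refine Finset.sum_congr rfl fun l _ => ?_
    simp only [band, Matrix.of_apply, endpoint, IsRelWalk, walkWeight, edges, List.map_cons,
      List.prod_cons, symEntry_mk]
    by_cases h1 : Relevant b x y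
    · simp [h1]
    · simp [h1]

theorem trace_band_pow (b : ℕ) (A : Matrix (Fin n) (Fin n) ℝ) (hA : A.IsSymm) (k : ℕ) :
    (band b A ^ k).trace =
      ∑ p ∈ closedWalks (Relevant b) k, walkWeight (symEntry A hA) p := by
  classical
  rw [closedWalks, Finset.sum_filter, Finset.sum_product]
  simp only [Matrix.trace, Matrix.diag, band_pow_apply b A hA k]

end Trace

/-! ### Second moments of sums of walk weights. -/

variable {Ω : Type*} [MeasurableSpace Ω]

/-- The entries of the scheme as functions of unordered pairs. -/
def TriangularScheme.sym (a : TriangularScheme Ω) (n : ℕ) (ω : Ω) : Sym2 (Fin n) → ℝ :=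
  symEntry (a.mat n ω) (a.isSymm n ω)

/-- Bounds for the mixed moments of the entries of a scheme, with summable deviations of the second
moments from `1`. -/
structure MomentBounds (P : Measure Ω) (a : TriangularScheme Ω) (C : ℕ → ℝ) (ε : ℕ → ℕ → ℝ) :
    Prop where
  integrable : ∀ (n : ℕ) (E : Finset (Sym2 (Fin n))) (δ : Sym2 (Fin n) → ℕ), (∀ e ∈ E, 1 ≤ δ e) →
    Integrable (fun ω => ∏ e ∈ E, a.sym n ω e ^ δ e) P
  decay : ∀ (n : ℕ) (E : Finset (Sym2 (Fin n))) (δ : Sym2 (Fin n) → ℕ), (∀ e ∈ E, 1 ≤ δ e) →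
    |∫ ω, ∏ e ∈ E, a.sym n ω e ^ δ e ∂P| ≤
      C (∑ e ∈ E, δ e) / √(n : ℝ) ^ (E.filter fun e => δ e = 1).card
  second : ∀ (n : ℕ) (E : Finset (Sym2 (Fin n))),
    |∫ ω, ∏ e ∈ E, a.sym n ω e ^ 2 ∂P - 1| ≤ ε E.card n
  summable : ∀ m, Summable (ε m)

section SecondMoment

/-- The second moment of a finite sum. -/
theorem integral_sq_sum_le {P : Measure Ω} {ι : Type*} (s : Finset ι) (f : ι → Ω → ℝ)
    (B : ι → ι → ℝ) (hint : ∀ i ∈ s, ∀ j ∈ s, Integrable (fun ω => f i ω * f j ω) P)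
    (hB : ∀ i ∈ s, ∀ j ∈ s, |∫ ω, f i ω * f j ω ∂P| ≤ B i j) :
    Integrable (fun ω => (∑ i ∈ s, f i ω) ^ 2) P ∧
      ∫ ω, (∑ i ∈ s, f i ω) ^ 2 ∂P ≤ ∑ i ∈ s, ∑ j ∈ s, B i j := by
  have e : (fun ω => (∑ i ∈ s, f i ω) ^ 2) = fun ω => ∑ i ∈ s, ∑ j ∈ s, f i ω * f j ω := by
    funext ω
    rw [sq, Finset.sum_mul_sum]
  rw [e]
  constructor
  · exact integrable_finsetSum _ fun i hi => integrable_finsetSum _ fun j hj => hint i hi j hj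
  · rw [integral_finsetSum _ fun i hi => integrable_finsetSum _ fun j hj => hint i hi j hj]
    refine Finset.sum_le_sum fun i hi => ?_
    rw [integral_finsetSum _ fun j hj => hint i hi j hj]
    exact Finset.sum_le_sum fun j hj => (le_abs_self _).trans (hB i hi j hj)

variable {P : Measure Ω} {a : TriangularScheme Ω} {C : ℕ → ℝ} {ε : ℕ → ℕ → ℝ}

theorem walkWeight_mul (f : Sym2 (Fin n) → ℝ) (p p' : Fin n × List (Fin n)) :
    walkWeight f p * walkWeight f p' =
      ∏ e ∈ (edges p.1 p.2 ++ edges p'.1 p'.2).toFinset,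
        f e ^ (edges p.1 p.2 ++ edges p'.1 p'.2).count e := by
  rw [walkWeight, walkWeight, ← List.prod_append, ← List.map_append, Finset.prod_list_map_count]

theorem walkWeight_eq_of_isDoubleTree (f : Sym2 (Fin n) → ℝ) {p : Fin n × List (Fin n)}
    (hp : IsDoubleTree p.1 p.2) :
    walkWeight f p = ∏ e ∈ (edges p.1 p.2).toFinset, f e ^ 2 := by
  rw [walkWeight, Finset.prod_list_map_count]
  refine Finset.prod_congr rfl fun e he => ?_
  rw [hp.count_eq_two e (List.mem_toFinset.1 he)]

theorem MomentBounds.integrable_mul (h : MomentBounds P a C ε) (n : ℕ)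
    (p p' : Fin n × List (Fin n)) :
    Integrable (fun ω => walkWeight (a.sym n ω) p * walkWeight (a.sym n ω) p') P := by
  simp only [walkWeight_mul]
  exact h.integrable n _ _ fun e he => List.count_pos_iff.2 (List.mem_toFinset.1 he)

theorem MomentBounds.abs_integral_mul_le (h : MomentBounds P a C ε) (n k : ℕ)
    (p p' : Fin n × List (Fin n)) (hp : p.2.length = k) (hp' : p'.2.length = k) :
    |∫ ω, walkWeight (a.sym n ω) p * walkWeight (a.sym n ω) p' ∂P| ≤
      C (2 * k) / √(n : ℝ) ^ singles (edges p.1 p.2 ++ edges p'.1 p'.2) := by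
  simp only [walkWeight_mul]
  have h1 := h.decay n (edges p.1 p.2 ++ edges p'.1 p'.2).toFinset
    (fun e => (edges p.1 p.2 ++ edges p'.1 p'.2).count e)
    fun e he => List.count_pos_iff.2 (List.mem_toFinset.1 he)
  rw [List.sum_toFinset_count_eq_length, List.length_append, edges_length, edges_length, hp, hp',
    ← two_mul] at h1
  exact h1

theorem MomentBounds.integrable_weight (h : MomentBounds P a C ε) (n : ℕ)
    (p : Fin n × List (Fin n)) : Integrable (fun ω => walkWeight (a.sym n ω) p) P := by
  -- The walk without steps has weight `1`.
  have := h.integrable_mul n p (p.1, [])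
  simpa [walkWeight, edges] using this

/-- The closed walks that are not double tree walks. -/
theorem MomentBounds.integral_sq_rest_le (h : MomentBounds P a C ε) {n : ℕ} (hn : 1 ≤ n) (k : ℕ)
    (s : Finset (Fin n × List (Fin n)))
    (hs : ∀ p ∈ s, p.2.length = k ∧ endpoint p.1 p.2 = p.1 ∧ ¬ IsDoubleTree p.1 p.2) :
    Integrable (fun ω => (∑ p ∈ s, walkWeight (a.sym n ω) p) ^ 2) P ∧
      ∫ ω, (∑ p ∈ s, walkWeight (a.sym n ω) p) ^ 2 ∂P ≤
        |C (2 * k)| * (((k + 1 : ℝ) + k + 1) ^ (k + 1) * ((k : ℝ) + 1) ^ (k + 1)) * (n : ℝ) ^ k := by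
  have : Nonempty (Fin n) := ⟨⟨0, hn⟩⟩
  have hn1 : (1 : ℝ) ≤ n := by exact_mod_cast hn
  have hs1 : (1 : ℝ) ≤ √(n : ℝ) := Real.one_le_sqrt.2 hn1
  have hsq : (n : ℝ) = √(n : ℝ) ^ 2 := (Real.sq_sqrt (by positivity)).symm
  -- The decay `√n ^ (-singles)` is at most `n ^ (k - |V ∪ V'|)` by the fundamental inequality, and
  -- the sum of `n ^ (-|V ∪ V'|)` over all pairs is bounded.
  have key := integral_sq_sum_le (P := P) s (fun p ω => walkWeight (a.sym n ω) p)
    (fun p p' => |C (2 * k)| * (n : ℝ) ^ k *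
      ((n : ℝ) ^ (verts p.1 p.2 ∪ verts p'.1 p'.2).card)⁻¹)
    (fun p _ p' _ => h.integrable_mul n p p') (fun p hp p' hp' => by
      obtain ⟨h1, h2, h3⟩ := hs p hp
      obtain ⟨h1', h2', h3'⟩ := hs p' hp'
      refine (h.abs_integral_mul_le n k p p' h1 h1').trans ?_
      rw [mul_assoc, div_eq_mul_inv]
      refine mul_le_mul (le_abs_self _) ?_ (by positivity) (abs_nonneg _)
      have hc := two_mul_card_union_verts_le h2 h2' h1 h1' h3 h3'
      rw [← div_eq_mul_inv, le_div_iff₀ (by positivity), inv_mul_le_iff₀ (by positivity)]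
      rw [mul_comm]
      calc (n : ℝ) ^ (verts p.1 p.2 ∪ verts p'.1 p'.2).card
          = √(n : ℝ) ^ (2 * (verts p.1 p.2 ∪ verts p'.1 p'.2).card) := by
            rw [pow_mul, ← hsq]
        _ ≤ √(n : ℝ) ^ (2 * k + singles (edges p.1 p.2 ++ edges p'.1 p'.2)) :=
            pow_le_pow_right₀ hs1 hc
        _ = _ := by rw [pow_add, pow_mul, ← hsq])
  refine ⟨key.1, key.2.trans ?_⟩
  have hsub : s ⊆ Finset.univ ×ˢ listsOfLength (Fin n) k := fun p hp => by
    simp [(hs p hp).1]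
  have h1 := sum_pairs_inv_pow_card_verts_le (V := Fin n) k
  simp only [Fintype.card_fin] at h1
  simp only [← Finset.mul_sum]
  rw [mul_right_comm]
  refine mul_le_mul_of_nonneg_right
    (mul_le_mul_of_nonneg_left (le_trans ?_ h1) (by positivity)) (by positivity)
  refine (Finset.sum_le_sum fun p _ => Finset.sum_le_sum_of_subset_of_nonneg hsub
    fun p' _ _ => by positivity).trans ?_
  exact Finset.sum_le_sum_of_subset_of_nonneg hsub fun p _ _ =>
    Finset.sum_nonneg fun p' _ => by positivity

/-- The closed double tree walks. -/
theorem MomentBounds.integral_sq_tree_le [IsProbabilityMeasure P] (h : MomentBounds P a C ε)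
    {n : ℕ} (hn : 1 ≤ n) (k : ℕ)
    (s : Finset (Fin n × List (Fin n)))
    (hs : ∀ p ∈ s, p.2.length = k ∧ IsDoubleTree p.1 p.2) :
    Integrable (fun ω => (∑ p ∈ s, (walkWeight (a.sym n ω) p - 1)) ^ 2) P ∧
      ∫ ω, (∑ p ∈ s, (walkWeight (a.sym n ω) p - 1)) ^ 2 ∂P ≤
        (|ε k n| + 2 * |ε (k / 2) n|) * (((k : ℝ) + 1) ^ (k + 1)) ^ 2 * (n : ℝ) ^ (k + 2) +
        (|C (2 * k)| + 1) *
          (((k + 1 : ℝ) + k + 1) ^ (k + 1) * ((k : ℝ) + 1) ^ (k + 1)) * (n : ℝ) ^ k := by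
  have : Nonempty (Fin n) := ⟨⟨0, hn⟩⟩
  have hn1 : (1 : ℝ) ≤ n := by exact_mod_cast hn
  have hs1 : (1 : ℝ) ≤ √(n : ℝ) := Real.one_le_sqrt.2 hn1
  have hsq : (n : ℝ) = √(n : ℝ) ^ 2 := (Real.sq_sqrt (by positivity)).symm
  have hexp : ∀ (p p' : Fin n × List (Fin n)), (fun ω =>
      (walkWeight (a.sym n ω) p - 1) * (walkWeight (a.sym n ω) p' - 1)) = fun ω =>
      walkWeight (a.sym n ω) p * walkWeight (a.sym n ω) p' - walkWeight (a.sym n ω) p -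
        walkWeight (a.sym n ω) p' + 1 := fun p p' => by funext ω; ring
  have hint : ∀ (p p' : Fin n × List (Fin n)), Integrable (fun ω =>
      (walkWeight (a.sym n ω) p - 1) * (walkWeight (a.sym n ω) p' - 1)) P := fun p p' => by
    rw [hexp]
    exact (((h.integrable_mul n p p').sub (h.integrable_weight n p)).sub
      (h.integrable_weight n p')).add (integrable_const 1)
  have hval : ∀ (p p' : Fin n × List (Fin n)), ∫ ω,
      (walkWeight (a.sym n ω) p - 1) * (walkWeight (a.sym n ω) p' - 1) ∂P =
      (∫ ω, walkWeight (a.sym n ω) p * walkWeight (a.sym n ω) p' ∂P - 1) -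
      (∫ ω, walkWeight (a.sym n ω) p ∂P - 1) - (∫ ω, walkWeight (a.sym n ω) p' ∂P - 1) :=
    fun p p' => by
    rw [hexp, integral_add, integral_sub, integral_sub]
    · simp
      ring
    · exact h.integrable_mul n p p'
    · exact h.integrable_weight n p
    · exact (h.integrable_mul n p p').sub (h.integrable_weight n p)
    · exact h.integrable_weight n p'
    · exact ((h.integrable_mul n p p').sub (h.integrable_weight n p)).sub
        (h.integrable_weight n p')
    · exact integrable_const 1
  have hone : ∀ p ∈ s, |∫ ω, walkWeight (a.sym n ω) p ∂P - 1| ≤ |ε (k / 2) n| := by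
    intro p hp
    obtain ⟨h1, h2⟩ := hs p hp
    simp only [walkWeight_eq_of_isDoubleTree _ h2]
    refine (h.second n _).trans ?_
    have hc := h2.two_mul_card_edges
    rw [h1] at hc
    have : (edges p.1 p.2).toFinset.card = k / 2 := by omega
    rw [this]
    exact le_abs_self _
  -- Without a common edge the two trees have `k` edges in total and the first summand bounds the
  -- pair. With a common edge the union has at most `k` vertices, so `n ^ k * n ^ (-|V ∪ V'|) ≥ 1`
  -- and the second summand absorbs the constant bound.
  have key := integral_sq_sum_le (P := P) s (fun p ω => walkWeight (a.sym n ω) p - 1)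
    (fun p p' => (|ε k n| + 2 * |ε (k / 2) n|) + (|C (2 * k)| + 1) * (n : ℝ) ^ k *
      ((n : ℝ) ^ (verts p.1 p.2 ∪ verts p'.1 p'.2).card)⁻¹)
    (fun p _ p' _ => hint p p') (fun p hp p' hp' => by
      obtain ⟨h1, h2⟩ := hs p hp
      obtain ⟨h1', h2'⟩ := hs p' hp'
      have ho := hone p hp
      have ho' := hone p' hp'
      rw [hval]
      have htri : ∀ u v w : ℝ, |u - v - w| ≤ |u| + |v| + |w| := fun u v w =>
        (abs_sub _ _).trans (add_le_add_left (abs_sub _ _) _)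
      refine (htri _ _ _).trans ?_
      by_cases hd : Disjoint (edges p.1 p.2).toFinset (edges p'.1 p'.2).toFinset
      · have hprod : ∀ ω, walkWeight (a.sym n ω) p * walkWeight (a.sym n ω) p' =
            ∏ e ∈ (edges p.1 p.2).toFinset ∪ (edges p'.1 p'.2).toFinset, a.sym n ω e ^ 2 := by
          intro ω
          rw [Finset.prod_union hd, walkWeight_eq_of_isDoubleTree _ h2,
            walkWeight_eq_of_isDoubleTree _ h2']
        have hb : |∫ ω, walkWeight (a.sym n ω) p * walkWeight (a.sym n ω) p' ∂P - 1| ≤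
            |ε k n| := by
          simp only [hprod]
          refine (h.second n _).trans ?_
          have hc := h2.two_mul_card_edges
          have hc' := h2'.two_mul_card_edges
          rw [Finset.card_union_of_disjoint hd]
          have : (edges p.1 p.2).toFinset.card + (edges p'.1 p'.2).toFinset.card = k := by omega
          rw [this]
          exact le_abs_self _
        have hpos : 0 ≤ (|C (2 * k)| + 1) * (n : ℝ) ^ k *
          ((n : ℝ) ^ (verts p.1 p.2 ∪ verts p'.1 p'.2).card)⁻¹ := by positivity
        linarith
      · have hc := h2.card_union_le h2' h1 h1' hd
        have hb := h.abs_integral_mul_le n k p p' h1 h1'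
        have hb2 : |∫ ω, walkWeight (a.sym n ω) p * walkWeight (a.sym n ω) p' ∂P| ≤
            |C (2 * k)| := by
          refine hb.trans ((div_le_div_of_nonneg_right (le_abs_self _) (by positivity)).trans ?_)
          exact div_le_self (abs_nonneg _) (one_le_pow₀ hs1)
        have hb3 : |∫ ω, walkWeight (a.sym n ω) p * walkWeight (a.sym n ω) p' ∂P - 1| ≤
            |C (2 * k)| + 1 := by
          refine (abs_sub _ _).trans ?_
          rw [abs_one]
          linarith
        have hge : (1 : ℝ) ≤ (n : ℝ) ^ k *
            ((n : ℝ) ^ (verts p.1 p.2 ∪ verts p'.1 p'.2).card)⁻¹ := by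
          rw [← div_eq_mul_inv, one_le_div₀ (by positivity)]
          exact pow_le_pow_right₀ hn1 hc
        have hge2 : |C (2 * k)| + 1 ≤ (|C (2 * k)| + 1) * (n : ℝ) ^ k *
            ((n : ℝ) ^ (verts p.1 p.2 ∪ verts p'.1 p'.2).card)⁻¹ := by
          rw [mul_assoc]
          exact le_mul_of_one_le_right (by positivity) hge
        have := abs_nonneg (ε k n)
        linarith)
  refine ⟨key.1, key.2.trans ?_⟩
  have hsub : s ⊆ Finset.univ ×ˢ listsOfLength (Fin n) k := fun p hp => by
    simp [(hs p hp).1]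
  -- A double tree walk visits `k/2 + 1` vertices, so there are `O(n ^ (k/2 + 1))` of them.
  have hcard := card_walks_le (V := Fin n) k (k + 2) s fun p hp =>
    ⟨(hs p hp).1, by rw [(hs p hp).2.two_mul_card_verts, (hs p hp).1]⟩
  rw [Fintype.card_fin] at hcard
  have h1 := sum_pairs_inv_pow_card_verts_le (V := Fin n) k
  simp only [Fintype.card_fin] at h1
  simp only [Finset.sum_add_distrib, Finset.sum_const, nsmul_eq_mul, ← Finset.mul_sum]
  refine add_le_add ?_ ?_
  · have h2 : (s.card : ℝ) * s.card ≤ (((k : ℝ) + 1) ^ (k + 1)) ^ 2 * (n : ℝ) ^ (k + 2) := by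
      calc (s.card : ℝ) * s.card ≤ (((k : ℝ) + 1) ^ (k + 1) * √(n : ℝ) ^ (k + 2)) *
            (((k : ℝ) + 1) ^ (k + 1) * √(n : ℝ) ^ (k + 2)) :=
            mul_le_mul hcard hcard (Nat.cast_nonneg _) ((Nat.cast_nonneg _).trans hcard)
        _ = (((k : ℝ) + 1) ^ (k + 1)) ^ 2 * (√(n : ℝ) ^ 2) ^ (k + 2) := by ring
        _ = _ := by rw [← hsq]
    have h3 : 0 ≤ |ε k n| + 2 * |ε (k / 2) n| := by positivity
    nlinarith [mul_le_mul_of_nonneg_left h2 h3]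
  · rw [mul_right_comm]
    refine mul_le_mul_of_nonneg_right
      (mul_le_mul_of_nonneg_left (le_trans ?_ h1) (by positivity)) (by positivity)
    refine (Finset.sum_le_sum fun p _ => Finset.sum_le_sum_of_subset_of_nonneg hsub
      fun p' _ _ => by positivity).trans ?_
    exact Finset.sum_le_sum_of_subset_of_nonneg hsub fun p _ _ =>
      Finset.sum_nonneg fun p' _ => by positivity

end SecondMoment

/-! ### Almost sure convergence of the moments. -/

section AlmostSure

variable {Ω : Type*} [MeasurableSpace Ω]

/-- Random variables with eventually summable second moments tend to zero almost surely. -/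
theorem ae_tendsto_zero_of_integral_sq_le {P : Measure Ω} (f : ℕ → Ω → ℝ) (B : ℕ → ℝ)
    (hB : Summable B)
    (h : ∀ᶠ n in atTop, Integrable (fun ω => f n ω ^ 2) P ∧ ∫ ω, f n ω ^ 2 ∂P ≤ B n) :
    ∀ᵐ ω ∂P, Tendsto (fun n => f n ω) atTop (𝓝 0) := by
  obtain ⟨N, hN⟩ := eventually_atTop.1 h
  have hN' : ∀ n, Integrable (fun ω => f (n + N) ω ^ 2) P ∧ ∫ ω, f (n + N) ω ^ 2 ∂P ≤ B (n + N) :=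
    fun n => hN (n + N) (Nat.le_add_left N n)
  have hmeas : ∀ n, AEMeasurable (fun ω => ENNReal.ofReal (f (n + N) ω ^ 2)) P := fun n =>
    (hN' n).1.aestronglyMeasurable.aemeasurable.ennreal_ofReal
  -- By Tonelli the sum of the squares has finite expectation, hence is almost surely finite, and
  -- its terms tend to zero.
  have hfin : ∫⁻ ω, ∑' n, ENNReal.ofReal (f (n + N) ω ^ 2) ∂P ≠ ∞ := by
    rw [lintegral_tsum hmeas]
    have hBN : Summable fun n => B (n + N) := (summable_nat_add_iff N).2 hB
    refine ne_top_of_le_ne_top hBN.tsum_ofReal_ne_top (ENNReal.tsum_le_tsum fun n => ?_)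
    rw [← ofReal_integral_eq_lintegral_ofReal (hN' n).1 (ae_of_all _ fun ω => sq_nonneg _)]
    exact ENNReal.ofReal_le_ofReal (hN' n).2
  filter_upwards [ae_lt_top' (AEMeasurable.tsum hmeas) hfin] with ω hω
  have h1 := ENNReal.tendsto_atTop_zero_of_tsum_ne_top hω.ne
  have h2 := (ENNReal.tendsto_toReal ENNReal.zero_ne_top).comp h1
  have h3 : Tendsto (fun n => f (n + N) ω ^ 2) atTop (𝓝 0) := by
    refine h2.congr fun n => ?_
    simp [ENNReal.toReal_ofReal (sq_nonneg _)]
  have h4 := (Real.continuous_sqrt.tendsto 0).comp h3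
  rw [Real.sqrt_zero] at h4
  refine (tendsto_add_atTop_iff_nat N).1 ?_
  rw [tendsto_zero_iff_abs_tendsto_zero]
  exact h4.congr fun n => Real.sqrt_sq_eq_abs _

theorem trace_bandMatrix_pow (a : TriangularScheme Ω) (b : ℕ → ℕ) (n k : ℕ) (ω : Ω) :
    (bandMatrix a b n ω ^ k).trace = (1 / √(b n : ℝ)) ^ k *
      ∑ p ∈ closedWalks (Relevant (b n)) k, walkWeight (a.sym n ω) p := by
  rw [bandMatrix, smul_pow, Matrix.trace_smul, trace_band_pow _ _ (a.isSymm n ω), smul_eq_mul]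
  rfl

/-- The deterministic part of the normalized trace converges to the number of lattice paths. -/
theorem tendsto_card_treeWalks (b : ℕ → ℕ) (hb : ∀ n, 1 ≤ n → IsBandwidth n (b n)) {c : ℝ}
    (hc : 0 < c) (hbc : ∀ᶠ n : ℕ in atTop, c * n ≤ b n) (k : ℕ) :
    Tendsto (fun n : ℕ => 1 / (n : ℝ) * (1 / √(b n : ℝ)) ^ k *
      ((treeWalks (V := Fin n) (Relevant (b n)) k).card : ℝ)) atTop (𝓝 (pathCount k 0)) := by
  rw [tendsto_iff_norm_sub_tendsto_zero]
  -- The counting error `O(n ^ (k/2))`, divided by `n * b_n ^ (k/2)` with `b_n ≥ c n`, is `O(1/n)`.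
  have hlim : Tendsto (fun n : ℕ => 2 ^ k * ((k : ℝ) + 1) ^ (k + 1) * (1 / √c) ^ k * (1 / (n : ℝ)))
      atTop (𝓝 0) := by
    have := tendsto_one_div_atTop_nhds_zero_nat (𝕜 := ℝ)
    simpa using this.const_mul (2 ^ k * ((k : ℝ) + 1) ^ (k + 1) * (1 / √c) ^ k)
  refine squeeze_zero' (Eventually.of_forall fun n => norm_nonneg _) ?_ hlim
  filter_upwards [hbc, eventually_ge_atTop 1] with n hcn hn
  have : Nonempty (Fin n) := ⟨⟨0, hn⟩⟩
  have hn0 : (0 : ℝ) < n := by exact_mod_cast hn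
  have hcn0 : 0 < c * n := by positivity
  have hb0 : (0 : ℝ) < b n := hcn0.trans_le hcn
  have hsb : 0 < √(b n : ℝ) := Real.sqrt_pos.2 hb0
  have hsc : 0 < √c := Real.sqrt_pos.2 hc
  have hsn : 0 < √(n : ℝ) := Real.sqrt_pos.2 hn0
  have key := abs_card_treeWalks_sub_le (V := Fin n) (Relevant (b n))
    (fun x y h => (relevant_comm x y).1 h) (b n) (fun x => card_relevant (hb n hn) x) k
  rw [Fintype.card_fin] at key
  have e : 1 / (n : ℝ) * (1 / √(b n : ℝ)) ^ k *
      ((treeWalks (V := Fin n) (Relevant (b n)) k).card : ℝ) - pathCount k 0 =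
      1 / (n : ℝ) * (1 / √(b n : ℝ)) ^ k *
      (((treeWalks (V := Fin n) (Relevant (b n)) k).card : ℝ) -
        n * (√(b n : ℝ) ^ k * pathCount k 0)) := by
    rw [one_div_pow]
    field_simp
  rw [e, norm_mul, Real.norm_eq_abs, Real.norm_eq_abs, abs_of_nonneg (by positivity)]
  have hle : (1 / √(b n : ℝ)) ^ k * √(n : ℝ) ^ k ≤ (1 / √c) ^ k := by
    rw [← mul_pow]
    refine pow_le_pow_left₀ (by positivity) ?_ k
    rw [one_div_mul_eq_div, div_le_div_iff₀ hsb hsc, one_mul, mul_comm, ← Real.sqrt_mul hc.le]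
    exact Real.sqrt_le_sqrt hcn
  calc _ ≤ 1 / (n : ℝ) * (1 / √(b n : ℝ)) ^ k *
        (2 ^ k * (((k : ℝ) + 1) ^ (k + 1) * √(n : ℝ) ^ k)) := by gcongr
    _ = 2 ^ k * ((k : ℝ) + 1) ^ (k + 1) * ((1 / √(b n : ℝ)) ^ k * √(n : ℝ) ^ k) *
        (1 / (n : ℝ)) := by ring
    _ ≤ _ := by gcongr

/-- The moments of the empirical spectral distributions converge almost surely. -/
theorem MomentBounds.ae_tendsto_trace {P : Measure Ω} [IsProbabilityMeasure P]
    {a : TriangularScheme Ω} {C : ℕ → ℝ} {ε : ℕ → ℕ → ℝ} (h : MomentBounds P a C ε) (b : ℕ → ℕ)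
    (hb : ∀ n, 1 ≤ n → IsBandwidth n (b n)) {c : ℝ}
    (hc : 0 < c) (hbc : ∀ᶠ n : ℕ in atTop, c * n ≤ b n) (k : ℕ) :
    ∀ᵐ ω ∂P, Tendsto (fun n : ℕ => 1 / (n : ℝ) * (bandMatrix a b n ω ^ k).trace) atTop
      (𝓝 (pathCount k 0)) := by
  classical
  set ν : ℕ → ℝ := fun n => 1 / (n : ℝ) * (1 / √(b n : ℝ)) ^ k with hν
  -- The square of the normalization is `b_n ^ (-k) / n ^ 2`: second moments of order `n ^ k` become
  -- summable, and the order `n ^ (k + 2)` of the tree part leaves just the summable `ε` terms.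
  have hνle : ∀ᶠ n : ℕ in atTop, 1 ≤ n ∧ ν n ^ 2 * (n : ℝ) ^ k ≤ (1 / c) ^ k * (1 / (n : ℝ) ^ 2) := by
    filter_upwards [hbc, eventually_ge_atTop 1] with n hcn hn
    have hn0 : (0 : ℝ) < n := by exact_mod_cast hn
    have hcn0 : 0 < c * n := by positivity
    have hb0 : (0 : ℝ) < b n := hcn0.trans_le hcn
    refine ⟨hn, ?_⟩
    have e : ν n ^ 2 * (n : ℝ) ^ k = ((n : ℝ) / (√(b n : ℝ) ^ 2)) ^ k * (1 / (n : ℝ) ^ 2) := by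
      simp only [hν]
      ring
    rw [e, Real.sq_sqrt hb0.le]
    have : (n : ℝ) / b n ≤ 1 / c := by
      rw [div_le_div_iff₀ hb0 hc]
      linarith
    gcongr
  set K : ℝ := ((k + 1 : ℝ) + k + 1) ^ (k + 1) * ((k : ℝ) + 1) ^ (k + 1) with hK
  set K' : ℝ := (((k : ℝ) + 1) ^ (k + 1)) ^ 2 with hK'
  have hsum2 : Summable fun n : ℕ => 1 / (n : ℝ) ^ 2 := Real.summable_one_div_nat_pow.2 one_lt_two
  have hrest := ae_tendsto_zero_of_integral_sq_le (P := P)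
    (fun n ω => ν n * ∑ p ∈ (closedWalks (V := Fin n) (Relevant (b n)) k).filter
      fun p => ¬ IsDoubleTree p.1 p.2, walkWeight (a.sym n ω) p)
    (fun n => |C (2 * k)| * K * (1 / c) ^ k * (1 / (n : ℝ) ^ 2)) (hsum2.mul_left _) (by
      filter_upwards [hνle] with n hn
      have h1 := h.integral_sq_rest_le hn.1 k
        ((closedWalks (V := Fin n) (Relevant (b n)) k).filter fun p => ¬ IsDoubleTree p.1 p.2)
        (fun p hp => by
          simp only [closedWalks, Finset.mem_filter, Finset.mem_product, Finset.mem_univ,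
            true_and, mem_listsOfLength] at hp
          exact ⟨hp.1.1, hp.1.2.1, hp.2⟩)
      simp only [mul_pow]
      refine ⟨h1.1.const_mul _, ?_⟩
      rw [integral_const_mul]
      calc _ ≤ ν n ^ 2 * (|C (2 * k)| * K * (n : ℝ) ^ k) :=
            mul_le_mul_of_nonneg_left h1.2 (sq_nonneg _)
        _ = |C (2 * k)| * K * (ν n ^ 2 * (n : ℝ) ^ k) := by ring
        _ ≤ |C (2 * k)| * K * ((1 / c) ^ k * (1 / (n : ℝ) ^ 2)) :=
            mul_le_mul_of_nonneg_left hn.2 (by positivity)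
        _ = _ := by ring)
  have htree := ae_tendsto_zero_of_integral_sq_le (P := P)
    (fun n ω => ν n * ∑ p ∈ treeWalks (V := Fin n) (Relevant (b n)) k,
      (walkWeight (a.sym n ω) p - 1))
    (fun n => (|ε k n| + 2 * |ε (k / 2) n|) * (K' * (1 / c) ^ k) +
      (|C (2 * k)| + 1) * K * (1 / c) ^ k * (1 / (n : ℝ) ^ 2))
    ((((h.summable k).abs.add ((h.summable (k / 2)).abs.mul_left 2)).mul_right _).add
      (hsum2.mul_left _)) (by
      filter_upwards [hνle] with n hn
      have hn0 : (0 : ℝ) < n := by exact_mod_cast hn.1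
      have h1 := h.integral_sq_tree_le hn.1 k (treeWalks (V := Fin n) (Relevant (b n)) k)
        (fun p hp => by
          simp only [treeWalks, closedWalks, Finset.mem_filter, Finset.mem_product,
            Finset.mem_univ, true_and, mem_listsOfLength] at hp
          exact ⟨hp.1.1, hp.2⟩)
      simp only [mul_pow]
      refine ⟨h1.1.const_mul _, ?_⟩
      rw [integral_const_mul]
      have hE : 0 ≤ |ε k n| + 2 * |ε (k / 2) n| := by positivity
      calc _ ≤ ν n ^ 2 * ((|ε k n| + 2 * |ε (k / 2) n|) * K' * (n : ℝ) ^ (k + 2) +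
              (|C (2 * k)| + 1) * K * (n : ℝ) ^ k) :=
            mul_le_mul_of_nonneg_left h1.2 (sq_nonneg _)
        _ = ((|ε k n| + 2 * |ε (k / 2) n|) * K' * (n : ℝ) ^ 2 + (|C (2 * k)| + 1) * K) *
              (ν n ^ 2 * (n : ℝ) ^ k) := by ring
        _ ≤ ((|ε k n| + 2 * |ε (k / 2) n|) * K' * (n : ℝ) ^ 2 + (|C (2 * k)| + 1) * K) *
              ((1 / c) ^ k * (1 / (n : ℝ) ^ 2)) :=
            mul_le_mul_of_nonneg_left hn.2 (by positivity)
        _ = _ := by field_simp)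
  -- The normalized trace is the rest, plus the deviations of the tree weights from `1`, plus the
  -- normalized number of tree walks.
  filter_upwards [hrest, htree] with ω h1 h2
  have h3 := (h1.add h2).add (tendsto_card_treeWalks b hb hc hbc k)
  rw [add_zero, zero_add] at h3
  refine h3.congr fun n => ?_
  rw [trace_bandMatrix_pow, ← Finset.sum_filter_add_sum_filter_not
    (closedWalks (V := Fin n) (Relevant (b n)) k) (fun p => IsDoubleTree p.1 p.2)]
  simp only [treeWalks, Finset.sum_sub_distrib, Finset.sum_const, nsmul_eq_mul, mul_one, hν]
  ring

end AlmostSure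

/-! ### Moments of the semicircle distribution. -/

section Semicircle

theorem measurable_semicircle_density : Measurable fun x : ℝ =>
    ENNReal.ofReal ((Set.Icc (-2) 2).indicator (fun y => 1 / (2 * Real.pi) * √(4 - y ^ 2)) x) := by
  refine ENNReal.measurable_ofReal.comp (Measurable.indicator ?_ measurableSet_Icc)
  fun_prop

theorem semicircle_density_nonneg (x : ℝ) :
    0 ≤ (Set.Icc (-2) 2).indicator (fun y => 1 / (2 * Real.pi) * √(4 - y ^ 2)) x :=
  Set.indicator_nonneg (fun y _ => by positivity) x

theorem integral_semicircle (f : ℝ → ℝ) :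
    ∫ x, f x ∂semicircle = ∫ x in (-2)..2, 1 / (2 * Real.pi) * √(4 - x ^ 2) * f x := by
  rw [semicircle, integral_withDensity_eq_integral_toReal_smul measurable_semicircle_density
    (ae_of_all _ fun x => ENNReal.ofReal_lt_top)]
  simp only [ENNReal.toReal_ofReal (semicircle_density_nonneg _), smul_eq_mul]
  rw [intervalIntegral.integral_of_le (by norm_num), ← integral_Icc_eq_integral_Ioc,
    ← integral_indicator measurableSet_Icc]
  congr 1
  funext x
  by_cases hx : x ∈ Set.Icc (-2 : ℝ) 2 <;> simp [hx]

theorem integrable_semicircle {f : ℝ → ℝ} (hf : Continuous f) : Integrable f semicircle := by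
  rw [semicircle, integrable_withDensity_iff measurable_semicircle_density
    (ae_of_all _ fun x => ENNReal.ofReal_lt_top)]
  simp only [ENNReal.toReal_ofReal (semicircle_density_nonneg _)]
  have e : (fun x => f x *
      (Set.Icc (-2) 2).indicator (fun y => 1 / (2 * Real.pi) * √(4 - y ^ 2)) x) =
      (Set.Icc (-2) 2).indicator fun x => f x * (1 / (2 * Real.pi) * √(4 - x ^ 2)) := by
    funext x
    by_cases hx : x ∈ Set.Icc (-2 : ℝ) 2 <;> simp [hx]
  rw [e, integrable_indicator_iff measurableSet_Icc]
  exact ContinuousOn.integrableOn_Icc (by fun_prop)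

/-- Substitute `x = 2 cos θ`: the square root becomes `2 sin θ`, and the Jacobian supplies the other
sine. -/
theorem integral_semicircle_eq_integral_cos {f : ℝ → ℝ} (hf : Continuous f) :
    ∫ x, f x ∂semicircle =
      ∫ θ in 0..Real.pi, 2 / Real.pi * Real.sin θ ^ 2 * f (2 * Real.cos θ) := by
  rw [integral_semicircle]
  have h := intervalIntegral.integral_comp_mul_deriv (a := 0) (b := Real.pi)
    (f := fun θ => 2 * Real.cos θ) (f' := fun θ => 2 * -Real.sin θ)
    (g := fun x => 1 / (2 * Real.pi) * √(4 - x ^ 2) * f x)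
    (fun θ _ => (Real.hasDerivAt_cos θ).const_mul 2) (by fun_prop) (by fun_prop)
  simp only [Real.cos_zero, Real.cos_pi, mul_one, mul_neg] at h
  rw [intervalIntegral.integral_symm, ← h, ← intervalIntegral.integral_neg]
  refine intervalIntegral.integral_congr fun θ hθ => ?_
  rw [Set.uIcc_of_le Real.pi_pos.le] at hθ
  have hs : √(4 - (2 * Real.cos θ) ^ 2) = 2 * Real.sin θ := by
    rw [← Real.sqrt_sq (mul_nonneg zero_le_two (Real.sin_nonneg_of_mem_Icc hθ))]
    congr 1
    have := Real.sin_sq_add_cos_sq θ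
    linear_combination (-4) * this
  simp only [Function.comp_apply, hs]
  field_simp

theorem integral_cos_nat_mul (m : ℕ) :
    ∫ θ in 0..Real.pi, Real.cos (m * θ) = if m = 0 then Real.pi else 0 := by
  split_ifs with hm
  · simp [hm]
  · have hm' : (m : ℝ) ≠ 0 := Nat.cast_ne_zero.2 hm
    rw [intervalIntegral.integral_comp_mul_left (fun x => Real.cos x) hm', integral_cos]
    simp

/-- `S_h (2 cos θ) sin θ = sin ((h + 1) θ)`, so the integrand is a difference of cosines of
frequencies `h` and `h + 2`, and only frequency zero has a nonzero integral. -/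
theorem integral_chebyshev_semicircle (h : ℕ) :
    ∫ x, (Polynomial.Chebyshev.S ℝ h).eval x ∂semicircle = if h = 0 then 1 else 0 := by
  rw [integral_semicircle_eq_integral_cos (Polynomial.continuous _)]
  have e : ∀ θ : ℝ, 2 / Real.pi * Real.sin θ ^ 2 *
      (Polynomial.Chebyshev.S ℝ h).eval (2 * Real.cos θ) =
      1 / Real.pi * (Real.cos ((h : ℕ) * θ) - Real.cos ((h + 2 : ℕ) * θ)) := by
    intro θ
    have h1 := Polynomial.Chebyshev.S_two_mul_real_cos θ h
    have h2 : Real.cos ((h : ℕ) * θ) - Real.cos ((h + 2 : ℕ) * θ) =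
        2 * (Real.sin ((h + 1) * θ) * Real.sin θ) := by
      have e1 : ((h : ℕ) : ℝ) * θ = (h + 1) * θ - θ := by ring
      have e2 : ((h + 2 : ℕ) : ℝ) * θ = (h + 1) * θ + θ := by push_cast; ring
      rw [e1, e2, Real.cos_sub, Real.cos_add]
      ring
    rw [h2]
    push_cast at h1
    rw [← h1]
    ring
  simp only [e]
  rw [intervalIntegral.integral_const_mul, intervalIntegral.integral_sub, integral_cos_nat_mul,
    integral_cos_nat_mul]
  · split_ifs <;> simp_all [Real.pi_ne_zero]
  · exact Continuous.intervalIntegrable (by fun_prop) _ _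
  · exact Continuous.intervalIntegrable (by fun_prop) _ _

/-- Since `x S_(h+1) = S_(h+2) + S_h` and `x S_0 = S_1`, multiplication by `x` acts on the index as
one step of a lattice path at height `h`. -/
theorem integral_pow_mul_chebyshev_semicircle (k h : ℕ) :
    ∫ x, x ^ k * (Polynomial.Chebyshev.S ℝ h).eval x ∂semicircle = pathCount k h := by
  induction k generalizing h with
  | zero =>
    simp only [pow_zero, one_mul, integral_chebyshev_semicircle]
    cases h <;> simp [pathCount]
  | succ k ih =>
    have hint : ∀ m : ℤ, Integrable
        (fun x : ℝ => x ^ k * (Polynomial.Chebyshev.S ℝ m).eval x) semicircle := fun m =>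
      integrable_semicircle (by fun_prop)
    cases h with
    | zero =>
      rw [pathCount, ← ih 1]
      refine integral_congr_ae (ae_of_all _ fun x => ?_)
      simp [pow_succ]
    | succ h =>
      rw [pathCount, ← ih (h + 2), ← ih h, ← integral_add (hint _) (hint _)]
      refine integral_congr_ae (ae_of_all _ fun x => ?_)
      have := congrArg (Polynomial.eval x) (Polynomial.Chebyshev.S_add_two ℝ h)
      simp only [Polynomial.eval_sub, Polynomial.eval_mul, Polynomial.eval_X] at this
      push_cast
      rw [this]
      ring

/-- The moments of the semicircle distribution count the lattice excursions. -/
theorem integral_pow_semicircle (k : ℕ) : ∫ x, x ^ k ∂semicircle = pathCount k 0 := by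
  rw [← integral_pow_mul_chebyshev_semicircle k 0]
  simp

/-- At most two choices per step. The growth rate `2` lies below the cutoff `3` used in the
polynomial approximation. -/
theorem pathCount_le (k h : ℕ) : pathCount k h ≤ 2 ^ k := by
  induction k generalizing h with
  | zero => cases h <;> simp [pathCount]
  | succ k ih =>
    have : (0 : ℝ) < 2 ^ k := by positivity
    cases h with
    | zero => rw [pathCount, pow_succ]; linarith [ih 1]
    | succ h => rw [pathCount, pow_succ]; linarith [ih (h + 2), ih h]

end Semicircle

/-! ### From convergence of moments to weak convergence. -/

section WeakConvergence

/-- A polynomial approximation of a bounded continuous function. -/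
theorem exists_polynomial_approx (f : ℝ →ᵇ ℝ) {ε : ℝ} (hε : 0 < ε) :
    ∃ (q : Polynomial ℝ) (A : ℝ), 0 ≤ A ∧ ∀ p : ℕ, q.natDegree ≤ p → ∀ x : ℝ,
      |f x - q.eval x| ≤ ε + A * (x / 3) ^ (2 * p) := by
  obtain ⟨q, hq⟩ := exists_polynomial_near_of_continuousOn (-3) 3 f f.continuous.continuousOn ε hε
  -- Outside `[-3, 3]` both `|f|` and `|q|` are dominated by a constant times `(x / 3) ^ (2 * p)`,
  -- because `|x / 3| ≥ 1` and the degree of `q` is at most `p`.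
  refine ⟨q, ‖f‖ + ∑ i ∈ Finset.range (q.natDegree + 1), |q.coeff i| * 3 ^ i, by positivity,
    fun p hp x => ?_⟩
  have heven : (x / 3) ^ (2 * p) = |x / 3| ^ (2 * p) := by
    rw [pow_mul, pow_mul, sq_abs]
  have hpos : 0 ≤ (x / 3) ^ (2 * p) := by rw [heven]; positivity
  by_cases hx : x ∈ Set.Icc (-3 : ℝ) 3
  · have h1 := hq x hx
    rw [abs_sub_comm] at h1
    refine h1.le.trans (le_add_of_nonneg_right (by positivity))
  · have h3 : 1 ≤ |x / 3| := by
      rw [abs_div, abs_of_pos (by norm_num : (0 : ℝ) < 3), le_div_iff₀ (by norm_num), one_mul]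
      by_contra hc
      exact hx (abs_le.1 (not_le.1 hc).le)
    have hone : 1 ≤ (x / 3) ^ (2 * p) := by rw [heven]; exact one_le_pow₀ h3
    have hq' : |q.eval x| ≤ (∑ i ∈ Finset.range (q.natDegree + 1), |q.coeff i| * 3 ^ i) *
        (x / 3) ^ (2 * p) := by
      rw [Polynomial.eval_eq_sum_range, Finset.sum_mul]
      refine (Finset.abs_sum_le_sum_abs _ _).trans (Finset.sum_le_sum fun i hi => ?_)
      rw [Finset.mem_range] at hi
      rw [abs_mul, abs_pow, mul_assoc]
      refine mul_le_mul_of_nonneg_left ?_ (abs_nonneg _)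
      have : |x| = 3 * |x / 3| := by
        rw [abs_div, abs_of_pos (by norm_num : (0 : ℝ) < 3)]
        ring
      rw [this, mul_pow, heven]
      exact mul_le_mul_of_nonneg_left (pow_le_pow_right₀ h3 (by omega)) (by positivity)
    have hf : |f x| ≤ ‖f‖ := f.norm_coe_le_norm x
    calc |f x - q.eval x| ≤ |f x| + |q.eval x| := abs_sub _ _
      _ ≤ ‖f‖ * (x / 3) ^ (2 * p) + (∑ i ∈ Finset.range (q.natDegree + 1), |q.coeff i| * 3 ^ i) *
        (x / 3) ^ (2 * p) :=
          add_le_add (hf.trans (le_mul_of_one_le_right (norm_nonneg _) hone)) hq'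
      _ ≤ _ := by rw [add_mul]; linarith

/-- Convergence of all moments to those of the semicircle distribution implies weak convergence. -/
theorem tendsto_mean_of_tendsto_moments (Λ : (n : ℕ) → Fin n → ℝ)
    (h : ∀ k : ℕ, Tendsto (fun n : ℕ => 1 / (n : ℝ) * ∑ i, Λ n i ^ k) atTop (𝓝 (pathCount k 0)))
    (f : ℝ →ᵇ ℝ) :
    Tendsto (fun n : ℕ => 1 / (n : ℝ) * ∑ i, f (Λ n i)) atTop (𝓝 (∫ x, f x ∂semicircle)) := by
  have hpoly : ∀ q : Polynomial ℝ, Tendsto (fun n : ℕ => 1 / (n : ℝ) * ∑ i, q.eval (Λ n i)) atTop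
      (𝓝 (∫ x, q.eval x ∂semicircle)) := by
    intro q
    simp only [Polynomial.eval_eq_sum_range]
    rw [integral_finsetSum _ fun k _ => integrable_semicircle (by fun_prop)]
    simp only [integral_const_mul, integral_pow_semicircle]
    have := tendsto_finsetSum (Finset.range (q.natDegree + 1))
      fun k _ => (h k).const_mul (q.coeff k)
    refine this.congr fun n => ?_
    rw [Finset.sum_comm, Finset.mul_sum]
    refine Finset.sum_congr rfl fun k _ => ?_
    rw [← Finset.mul_sum]
    ring
  rw [Metric.tendsto_atTop']
  intro η hη
  -- The final error is less than `2ε + ε + 2ε = 5ε < η`: replacing `f` by `q` under the empirical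
  -- and the semicircle distribution, and convergence for `q`.
  set ε := η / 8 with hε
  have hε0 : 0 < ε := by positivity
  obtain ⟨q, A, hA, hq⟩ := exists_polynomial_approx f hε0
  -- The `2p`-th semicircle moment is at most `4 ^ p`, against the `9 ^ p` from the cutoff at `3`.
  obtain ⟨p, hp, hp'⟩ : ∃ p, q.natDegree ≤ p ∧ A * (4 / 9 : ℝ) ^ p < ε := by
    have h1 : Tendsto (fun p : ℕ => A * (4 / 9 : ℝ) ^ p) atTop (𝓝 0) := by
      simpa using (tendsto_pow_atTop_nhds_zero_of_lt_one (by norm_num)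
        (by norm_num : (4 / 9 : ℝ) < 1)).const_mul A
    obtain ⟨p, hp⟩ := ((eventually_ge_atTop q.natDegree).and (h1.eventually_lt_const hε0)).exists
    exact ⟨p, hp⟩
  have hb := hq p hp
  have hmom : pathCount (2 * p) 0 * (A / 9 ^ p) < ε := by
    refine lt_of_le_of_lt ?_ hp'
    calc pathCount (2 * p) 0 * (A / 9 ^ p) ≤ 2 ^ (2 * p) * (A / 9 ^ p) := by
          gcongr
          exact pathCount_le _ _
      _ = A * (4 / 9 : ℝ) ^ p := by
          rw [pow_mul, div_pow]
          norm_num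
          ring
  have e9 : ∀ x : ℝ, ε + A * (x / 3) ^ (2 * p) = ε + A / 9 ^ p * x ^ (2 * p) := by
    intro x
    have : (9 : ℝ) ^ p = 3 ^ (2 * p) := by rw [pow_mul]; norm_num
    rw [div_pow, this]
    ring
  simp only [e9] at hb
  have hσ : |∫ x, f x ∂semicircle - ∫ x, q.eval x ∂semicircle| < 2 * ε := by
    rw [← integral_sub (integrable_semicircle f.continuous)
      (integrable_semicircle (Polynomial.continuous q))]
    refine (abs_integral_le_integral_abs).trans_lt ?_
    have h1 : ∫ x, |f x - q.eval x| ∂semicircle ≤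
        ∫ x, (ε + A / 9 ^ p * x ^ (2 * p)) ∂semicircle :=
      integral_mono (integrable_semicircle (by fun_prop)) (integrable_semicircle (by fun_prop)) hb
    have h2 : ∫ x, (ε + A / 9 ^ p * x ^ (2 * p)) ∂semicircle =
        ε + A / 9 ^ p * pathCount (2 * p) 0 := by
      rw [integral_add (integrable_semicircle (by fun_prop)) (integrable_semicircle (by fun_prop)),
        integral_const_mul, integral_pow_semicircle]
      have h3 := integral_pow_semicircle 0
      simp only [pow_zero, pathCount] at h3
      have h4 : ∫ _x : ℝ, ε ∂semicircle = ε * ∫ _x : ℝ, (1 : ℝ) ∂semicircle := by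
        rw [← integral_const_mul]
        simp
      rw [h4, h3, mul_one]
    linarith
  have hev := (hpoly q).eventually (Metric.ball_mem_nhds _ hε0)
  have hev2 := (h (2 * p)).mul_const (A / 9 ^ p) |>.eventually_lt_const hmom
  obtain ⟨N, hN⟩ := eventually_atTop.1 ((hev.and hev2).and (eventually_ge_atTop 1))
  refine ⟨N, fun n hn => ?_⟩
  obtain ⟨⟨h1, h2⟩, h3⟩ := hN n hn.le
  have hn0 : (0 : ℝ) < n := by exact_mod_cast h3
  rw [Real.dist_eq] at h1
  rw [Real.dist_eq]
  have h4 : |1 / (n : ℝ) * ∑ i, f (Λ n i) - 1 / (n : ℝ) * ∑ i, q.eval (Λ n i)| < 2 * ε := by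
    rw [← mul_sub, ← Finset.sum_sub_distrib, abs_mul, abs_of_pos (by positivity)]
    calc 1 / (n : ℝ) * |∑ i, (f (Λ n i) - q.eval (Λ n i))|
        ≤ 1 / (n : ℝ) * ∑ i, (ε + A / 9 ^ p * Λ n i ^ (2 * p)) := by
          refine mul_le_mul_of_nonneg_left ?_ (by positivity)
          exact (Finset.abs_sum_le_sum_abs _ _).trans (Finset.sum_le_sum fun i _ => hb _)
      _ = ε + 1 / (n : ℝ) * (∑ i, Λ n i ^ (2 * p)) * (A / 9 ^ p) := by
          rw [Finset.sum_add_distrib, ← Finset.mul_sum, Finset.sum_const, Finset.card_univ,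
            Fintype.card_fin, nsmul_eq_mul]
          field_simp
      _ < 2 * ε := by linarith
  rw [abs_lt] at *
  constructor <;> linarith

theorem trace_pow_eq_sum_eigenvalues {n : ℕ} {A : Matrix (Fin n) (Fin n) ℝ} (hA : A.IsHermitian)
    (k : ℕ) : (A ^ k).trace = ∑ i, hA.eigenvalues i ^ k := by
  conv_lhs => rw [hA.spectral_theorem, ← map_pow, Unitary.conjStarAlgAut_apply,
    Matrix.trace_mul_cycle]
  simp [Matrix.diagonal_pow, Matrix.trace_diagonal]

theorem integral_esd {n : ℕ} {A : Matrix (Fin n) (Fin n) ℝ} (hA : A.IsHermitian) (f : ℝ →ᵇ ℝ) :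
    ∫ x, f x ∂(esd hA) = 1 / (n : ℝ) * ∑ i, f (hA.eigenvalues i) := by
  rw [esd, integral_smul_measure, integral_finsetSum_measure]
  · simp
  · intro i _
    exact f.integrable _

end WeakConvergence

/-! ### Deriving the moment bounds from the three hypotheses. -/

section Reductions

variable {Ω : Type*} [MeasurableSpace Ω]

theorem TriangularScheme.sym_mk (a : TriangularScheme Ω) (n : ℕ) (ω : Ω) (i j : Fin n) :
    a.sym n ω s(i, j) = a.mat n ω i j := rfl

theorem TriangularScheme.measurable_sym (a : TriangularScheme Ω) (n : ℕ) (e : Sym2 (Fin n)) :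
    Measurable fun ω => a.sym n ω e := by
  induction e with
  | _ i j => exact a.measurable_entry n i j

/-- An enumeration of a finite set of unordered pairs by pairwise fundamentally different pairs. -/
theorem exists_enumeration {n : ℕ} (E : Finset (Sym2 (Fin n))) :
    ∃ (x : Fin E.card → Fin n × Fin n) (u : Fin E.card ≃ E),
      (Pairwise fun i j => FundamentallyDifferent (x i) (x j)) ∧
      ∀ i, s((x i).1, (x i).2) = (u i : Sym2 (Fin n)) := by
  have hex : ∀ e : Sym2 (Fin n), ∃ p : Fin n × Fin n, s(p.1, p.2) = e := by
    intro e
    induction e with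
    | _ i j => exact ⟨(i, j), rfl⟩
  choose r hr using hex
  refine ⟨fun i => r (E.equivFin.symm i), E.equivFin.symm, fun i j hij hc => hij ?_, fun i => hr _⟩
  simp only [hr] at hc
  exact E.equivFin.symm.injective (Subtype.ext hc)

theorem entry_eq_sym (a : TriangularScheme Ω) {n : ℕ} (x : Fin n × Fin n) (ω : Ω) :
    a.entry le_rfl x ω = a.sym n ω s(x.1, x.2) := rfl

/-- Passes from families of ordered pairs to finite sets of unordered pairs, using the condition
with `N = n` for an enumeration of `E`. -/
theorem AAU1.sym {P : Measure Ω} {a : TriangularScheme Ω} {α : ℝ} {C : ℕ → ℝ} (h : AAU1 P a α C)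
    {n : ℕ} (E : Finset (Sym2 (Fin n))) (hE : E.Nonempty) (δ : Sym2 (Fin n) → ℕ)
    (hδ : ∀ e ∈ E, 1 ≤ δ e) :
    Integrable (fun ω => ∏ e ∈ E, a.sym n ω e ^ δ e) P ∧
      |∫ ω, ∏ e ∈ E, a.sym n ω e ^ δ e ∂P| ≤
        C (∑ e ∈ E, δ e) / (n : ℝ) ^ (α * ((E.filter fun e => δ e = 1).card : ℝ)) := by
  obtain ⟨x, u, hx, hu⟩ := exists_enumeration E
  have key := h n E.card (Finset.card_pos.2 hE) x hx (fun i => δ (u i)) (fun i => hδ _ (u i).2) n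
    le_rfl
  have e1 : ∀ ω, ∏ i, a.entry le_rfl (x i) ω ^ δ (u i) = ∏ e ∈ E, a.sym n ω e ^ δ e := by
    intro ω
    simp only [entry_eq_sym, hu]
    rw [Equiv.prod_comp u fun e : E => a.sym n ω e ^ δ e,
      Finset.prod_coe_sort E fun e => a.sym n ω e ^ δ e]
  have e2 : ∑ i, δ (u i) = ∑ e ∈ E, δ e := by
    rw [Equiv.sum_comp u fun e : E => δ e, Finset.sum_coe_sort E δ]
  have e3 : (Finset.univ.filter fun i => δ (u i) = 1).card = (E.filter fun e => δ e = 1).card := by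
    rw [Finset.card_filter, Finset.card_filter,
      Equiv.sum_comp u fun e : E => if δ e = 1 then 1 else 0,
      Finset.sum_coe_sort E fun e => if δ e = 1 then 1 else 0]
  simp only [e1, e2, e3] at key
  exact key

theorem AAU2.sym {P : Measure Ω} {a : TriangularScheme Ω} {C' : ℕ → ℕ → ℝ} (h : AAU2 P a C')
    {n : ℕ} (E : Finset (Sym2 (Fin n))) (hE : E.Nonempty) :
    |∫ ω, ∏ e ∈ E, a.sym n ω e ^ 2 ∂P - 1| ≤ C' E.card n := by
  obtain ⟨x, u, hx, hu⟩ := exists_enumeration E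
  have key := h n E.card (Finset.card_pos.2 hE) x hx n le_rfl
  have e1 : ∀ ω, ∏ i, a.entry le_rfl (x i) ω ^ 2 = ∏ e ∈ E, a.sym n ω e ^ 2 := by
    intro ω
    simp only [entry_eq_sym, hu]
    rw [Equiv.prod_comp u fun e : E => a.sym n ω e ^ 2,
      Finset.prod_coe_sort E fun e => a.sym n ω e ^ 2]
  simp only [e1] at key
  exact key

/-- Replace every factor by the one of largest absolute value. This bounds mixed moments by absolute
moments of single entries. -/
theorem abs_prod_pow_le_sum {ι : Type*} (E : Finset ι) (hE : E.Nonempty) (δ : ι → ℕ) (x : ι → ℝ) :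
    |∏ e ∈ E, x e ^ δ e| ≤ ∑ e ∈ E, |x e| ^ (∑ e ∈ E, δ e) := by
  obtain ⟨e₀, he₀, hmax⟩ := E.exists_max_image (fun e => |x e|) hE
  rw [Finset.abs_prod]
  calc ∏ e ∈ E, |x e ^ δ e| ≤ ∏ e ∈ E, |x e₀| ^ δ e := by
        refine Finset.prod_le_prod (fun e _ => abs_nonneg _) fun e he => ?_
        rw [abs_pow]
        exact pow_le_pow_left₀ (abs_nonneg _) (hmax e he) _
    _ = |x e₀| ^ (∑ e ∈ E, δ e) := Finset.prod_pow_eq_pow_sum _ _ _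
    _ ≤ _ := Finset.single_le_sum (f := fun e => |x e| ^ (∑ e ∈ E, δ e))
        (fun e _ => by positivity) he₀

theorem IsWignerScheme.integral_prod_pow {P : Measure Ω} {a : TriangularScheme Ω}
    (h : IsWignerScheme P a) {n : ℕ}
    (E : Finset (Sym2 (Fin n))) (δ : Sym2 (Fin n) → ℕ) :
    ∫ ω, ∏ e ∈ E, a.sym n ω e ^ δ e ∂P = ∏ e ∈ E, ∫ ω, a.sym n ω e ^ δ e ∂P := by
  -- Each unordered pair is represented in the upper triangle, where independence is assumed.
  have hex : ∀ e : Sym2 (Fin n), ∃ p : {x : Fin n × Fin n // x.1 ≤ x.2}, s(p.1.1, p.1.2) = e := by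
    intro e
    induction e with
    | _ i j =>
      rcases le_total i j with hij | hij
      · exact ⟨⟨(i, j), hij⟩, rfl⟩
      · exact ⟨⟨(j, i), hij⟩, Sym2.eq_swap⟩
  choose φ hφ using hex
  have hinj : Function.Injective fun e : E => φ e := by
    intro e e' he
    refine Subtype.ext ?_
    rw [← hφ e, ← hφ e']
    simp only at he
    rw [he]
  have hind := (h.indep n).precomp hinj
  have key := hind.integral_fun_prod_comp (f := fun (e : E) (t : ℝ) => t ^ δ e)
    (fun e => (a.measurable_entry n _ _).aemeasurable)
    (fun e => (measurable_id.pow_const _).aestronglyMeasurable)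
  have e1 : ∀ (e : E) (ω : Ω), a.mat n ω (φ e).1.1 (φ e).1.2 = a.sym n ω e := by
    intro e ω
    rw [← a.sym_mk, hφ]
  simp only [e1] at key
  rw [Finset.prod_coe_sort E fun e => ∫ ω, a.sym n ω e ^ δ e ∂P] at key
  rw [← key]
  congr 1
  funext ω
  rw [Finset.prod_coe_sort E fun e => a.sym n ω e ^ δ e]

variable {P : Measure Ω} [IsProbabilityMeasure P] {a : TriangularScheme Ω}

/-- For `n ≥ 1` and `α ≥ 1/2` the decay `n ^ (-α s)` is at least as strong as `√n ^ (-s)`. The `+ 1`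
in the constant covers the empty product, whose expectation is `1`. -/
theorem AAU1.momentBounds {α : ℝ} (hα : 1 / 2 ≤ α) {C : ℕ → ℝ} (h : AAU1 P a α C)
    {ε : ℕ → ℕ → ℝ} (hsecond : ∀ (n : ℕ) (E : Finset (Sym2 (Fin n))),
      |∫ ω, ∏ e ∈ E, a.sym n ω e ^ 2 ∂P - 1| ≤ ε E.card n) (hsum : ∀ m, Summable (ε m)) :
    MomentBounds P a (fun m => |C m| + 1) ε where
  integrable n E δ hδ := by
    rcases E.eq_empty_or_nonempty with rfl | hE
    · simp
    · exact (h.sym E hE δ hδ).1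
  decay n E δ hδ := by
    rcases E.eq_empty_or_nonempty with rfl | hE
    · simp
    · refine (h.sym E hE δ hδ).2.trans ?_
      have hn : (1 : ℝ) ≤ n := by
        obtain ⟨e, -⟩ := hE
        induction e with
        | _ i j => exact_mod_cast i.pos
      set s := (E.filter fun e => δ e = 1).card
      have h1 : √(n : ℝ) ^ s ≤ (n : ℝ) ^ (α * (s : ℝ)) := by
        rw [Real.sqrt_eq_rpow, ← Real.rpow_natCast, ← Real.rpow_mul (by linarith)]
        exact Real.rpow_le_rpow_of_exponent_le hn (by gcongr)
      have h2 : 0 < √(n : ℝ) ^ s := by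
        have : 0 < √(n : ℝ) := Real.sqrt_pos.2 (by linarith)
        positivity
      exact div_le_div₀ (by positivity) (by linarith [le_abs_self (C (∑ e ∈ E, δ e))]) h2 h1
  second := hsecond
  summable := hsum

theorem AlmostUncorrelatedWith.momentBounds {α : ℝ} (hα : 1 / 2 ≤ α) {C : ℕ → ℝ}
    {C' : ℕ → ℕ → ℝ} (h : AlmostUncorrelatedWith P a α C C')
    (hsum : ∀ l, 1 ≤ l → Summable (C' l)) :
    -- The constants are controlled only for `m ≥ 1`; for `m = 0` the empty product has no
    -- deviation.
    MomentBounds P a (fun m => |C m| + 1) (fun m n => if m = 0 then 0 else C' m n) :=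
  h.aau1.momentBounds hα (fun n E => by
    rcases E.eq_empty_or_nonempty with rfl | hE
    · simp
    · rw [if_neg (Finset.card_pos.2 hE).ne']
      exact h.aau2.sym E hE) fun m => by
    by_cases hm : m = 0
    · simp [hm]
    · simpa [hm] using hsum m (Nat.pos_of_ne_zero hm)

/-- Squares of signs are `1`, so the second moment condition holds without error. -/
theorem AAU1.momentBounds_of_sign {α : ℝ} (hα : 1 / 2 ≤ α) {C : ℕ → ℝ} (h : AAU1 P a α C)
    (hsign : ∀ (n : ℕ) (p q : Fin n), ∀ᵐ ω ∂P, a.mat n ω p q = -1 ∨ a.mat n ω p q = 1) :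
    MomentBounds P a (fun m => |C m| + 1) (fun _ _ => 0) :=
  h.momentBounds hα (fun n E => by
    have h1 : ∀ᵐ ω ∂P, ∀ e : Sym2 (Fin n), a.sym n ω e ^ 2 = 1 := by
      refine ae_all_iff.2 fun e => ?_
      induction e with
      | _ i j =>
        filter_upwards [hsign n i j] with ω hω
        rw [a.sym_mk]
        rcases hω with hω | hω <;> simp [hω]
    have h2 : ∫ ω, ∏ e ∈ E, a.sym n ω e ^ 2 ∂P = ∫ _ω, (1 : ℝ) ∂P := by
      refine integral_congr_ae ?_
      filter_upwards [h1] with ω hω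
      exact Finset.prod_eq_one fun e _ => hω e
    simp [h2]) fun _ => summable_zero

/-- By independence a mixed moment with an exponent equal to one vanishes, and expected products of
squares equal `1` exactly. -/
theorem IsWignerScheme.exists_momentBounds (h : IsWignerScheme P a) :
    ∃ C : ℕ → ℝ, MomentBounds P a C fun _ _ => 0 := by
  have hex : ∀ p : ℕ, ∃ C : ℝ, 0 < C ∧ (1 ≤ p → ∀ (n : ℕ) (i j : Fin n),
      Integrable (fun ω => |a.mat n ω i j| ^ p) P ∧ ∫ ω, |a.mat n ω i j| ^ p ∂P ≤ C) := by
    intro p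
    by_cases hp : 1 ≤ p
    · obtain ⟨C, hC, hC'⟩ := h.moments p hp
      exact ⟨C, hC, fun _ => hC'⟩
    · exact ⟨1, one_pos, fun hp' => (hp hp').elim⟩
  choose C hC hmom using hex
  have hsym : ∀ p, 1 ≤ p → ∀ (n : ℕ) (e : Sym2 (Fin n)),
      Integrable (fun ω => |a.sym n ω e| ^ p) P ∧ ∫ ω, |a.sym n ω e| ^ p ∂P ≤ C p := by
    intro p hp n e
    induction e with
    | _ i j => exact hmom p hp n i j
  have hD : ∀ {n : ℕ} {E : Finset (Sym2 (Fin n))} {δ : Sym2 (Fin n) → ℕ}, E.Nonempty →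
      (∀ e ∈ E, 1 ≤ δ e) → 1 ≤ ∑ e ∈ E, δ e := by
    rintro n E δ ⟨e, he⟩ hδ
    exact (hδ e he).trans (Finset.single_le_sum (fun _ _ => Nat.zero_le _) he)
  have hdom : ∀ {n : ℕ} {E : Finset (Sym2 (Fin n))} {δ : Sym2 (Fin n) → ℕ}, E.Nonempty →
      (∀ e ∈ E, 1 ≤ δ e) →
      Integrable (fun ω => ∑ e ∈ E, |a.sym n ω e| ^ (∑ e ∈ E, δ e)) P := fun hE hδ =>
    integrable_finsetSum _ fun e _ => (hsym _ (hD hE hδ) _ e).1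
  have hint : ∀ (n : ℕ) (E : Finset (Sym2 (Fin n))) (δ : Sym2 (Fin n) → ℕ), (∀ e ∈ E, 1 ≤ δ e) →
      Integrable (fun ω => ∏ e ∈ E, a.sym n ω e ^ δ e) P := by
    intro n E δ hδ
    rcases E.eq_empty_or_nonempty with rfl | hE
    · simp
    · refine (hdom hE hδ).mono' ?_ (ae_of_all _ fun ω => abs_prod_pow_le_sum E hE δ _)
      exact (Finset.measurable_fun_prod _ fun e _ =>
        (a.measurable_sym n e).pow_const _).aestronglyMeasurable
  -- Exponents are at least one, so a moment of total degree `m` involves at most `m` entries, each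
  -- with `m`-th absolute moment at most `C m`; `+ 1` again covers the empty product.
  refine ⟨fun m => m * C m + 1, hint, fun n E δ hδ => ?_, fun n E => ?_, fun _ => summable_zero⟩
  · have hpos : ∀ m : ℕ, 0 ≤ m * C m := fun m => mul_nonneg (Nat.cast_nonneg m) (hC m).le
    rcases E.eq_empty_or_nonempty with rfl | hE
    · simp
    by_cases hs : (E.filter fun e => δ e = 1).Nonempty
    · obtain ⟨e, he⟩ := hs
      rw [Finset.mem_filter] at he
      rw [h.integral_prod_pow, Finset.prod_eq_zero he.1, abs_zero]
      · have := hpos (∑ e ∈ E, δ e)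
        positivity
      · rw [he.2]
        simp only [pow_one]
        obtain ⟨he, -⟩ := he
        induction e with
        | _ i j => exact h.mean_zero n i j
    · rw [Finset.not_nonempty_iff_eq_empty.1 hs, Finset.card_empty, pow_zero, div_one]
      calc |∫ ω, ∏ e ∈ E, a.sym n ω e ^ δ e ∂P| ≤ ∫ ω, |∏ e ∈ E, a.sym n ω e ^ δ e| ∂P :=
            abs_integral_le_integral_abs
        _ ≤ ∫ ω, ∑ e ∈ E, |a.sym n ω e| ^ (∑ e ∈ E, δ e) ∂P :=
            integral_mono (hint n E δ hδ).abs (hdom hE hδ) fun ω => abs_prod_pow_le_sum E hE δ _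
        _ = ∑ e ∈ E, ∫ ω, |a.sym n ω e| ^ (∑ e ∈ E, δ e) ∂P :=
            integral_finsetSum _ fun e _ => (hsym _ (hD hE hδ) _ e).1
        _ ≤ ∑ _e ∈ E, C (∑ e ∈ E, δ e) :=
            Finset.sum_le_sum fun e _ => (hsym _ (hD hE hδ) _ e).2
        _ = E.card * C (∑ e ∈ E, δ e) := by rw [Finset.sum_const, nsmul_eq_mul]
        _ ≤ (∑ e ∈ E, δ e : ℕ) * C (∑ e ∈ E, δ e) := by
            refine mul_le_mul_of_nonneg_right ?_ (hC _).le
            have : E.card ≤ ∑ e ∈ E, δ e := by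
              rw [Finset.card_eq_sum_ones]
              exact Finset.sum_le_sum hδ
            exact_mod_cast this
        _ ≤ _ := by linarith
  · rw [h.integral_prod_pow E fun _ => 2, Finset.prod_eq_one]
    · simp
    · intro e _
      induction e with
      | _ i j =>
        simp only [a.sym_mk]
        have h1 := h.variance_one n i j
        rw [variance_eq_integral (a.measurable_entry n i j).aemeasurable, h.mean_zero n i j] at h1
        simpa using h1

/-- The semicircle law holds almost surely under the moment bounds. -/
theorem MomentBounds.semicircleLaw {C : ℕ → ℝ} {ε : ℕ → ℕ → ℝ} (h : MomentBounds P a C ε)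
    (b : ℕ → ℕ) (hb : ∀ n, 1 ≤ n → IsBandwidth n (b n)) {c : ℝ}
    (hc : 0 < c) (hbc : ∀ᶠ n : ℕ in atTop, c * n ≤ b n) :
    SemicircleLawAlmostSurely P (bandMatrix a b) (bandMatrix_isHermitian a b) := by
  intro f
  -- Countably many moments share one exceptional null set.
  filter_upwards [ae_all_iff.2 fun k => h.ae_tendsto_trace b hb hc hbc k] with ω hω
  simp only [integral_esd]
  refine tendsto_mean_of_tendsto_moments
    (fun n => (bandMatrix_isHermitian a b n ω).eigenvalues) (fun k => ?_) f
  refine (hω k).congr fun n => ?_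
  rw [trace_pow_eq_sum_eigenvalues (bandMatrix_isHermitian a b n ω)]

end Reductions

/-- A sequence of bandwidths with a positive lower density is eventually bounded below by a multiple
of the dimension. -/
theorem exists_mul_le_of_liminf_pos {b : ℕ → ℕ}
    (hlim : 0 < liminf (fun n : ℕ => (b n : ℝ) / (n : ℝ)) atTop) :
    ∃ c : ℝ, 0 < c ∧ ∀ᶠ n : ℕ in atTop, c * n ≤ b n := by
  obtain ⟨c, hc, hc'⟩ := exists_between hlim
  refine ⟨c, hc, ?_⟩
  -- A real-valued `liminf` is meaningful only for sequences bounded below; here `0` is a bound.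
  have h1 := eventually_lt_of_lt_liminf hc' (isBoundedUnder_of ⟨0, fun n => by positivity⟩)
  filter_upwards [h1, eventually_ge_atTop 1] with n hn hn1
  have hn0 : (0 : ℝ) < n := by exact_mod_cast hn1
  exact ((lt_div_iff₀ hn0).1 hn).le

end BandSemicircle

theorem corollary2p6 {Ω : Type*} [MeasurableSpace Ω] (P : Measure Ω) [IsProbabilityMeasure P]
    (a : BandSemicircle.TriangularScheme Ω) (b : ℕ → ℕ)
    (hb : ∀ n, 1 ≤ n → BandSemicircle.IsBandwidth n (b n))
    (hlim : 0 < liminf (fun n : ℕ => (b n : ℝ) / (n : ℝ)) atTop)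
    (h : (∃ α : ℝ, 1 / 2 ≤ α ∧ BandSemicircle.AlmostUncorrelated P a α ∧
            ∀ (n : ℕ) (p q : Fin n), ∀ᵐ ω ∂P, a.mat n ω p q = -1 ∨ a.mat n ω p q = 1) ∨
         (∃ (α : ℝ) (C : ℕ → ℝ) (C' D : ℕ → ℕ → ℝ), 1 / 2 < α ∧
            BandSemicircle.StronglyAlmostUncorrelatedWith P a α C C' D ∧
            ∀ l, 1 ≤ l → (Summable fun n => C' l n) ∧ Summable fun n : ℕ => D l n / (n : ℝ)) ∨
         BandSemicircle.IsWignerScheme P a) :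
    BandSemicircle.SemicircleLawAlmostSurely P (BandSemicircle.bandMatrix a b)
      (BandSemicircle.bandMatrix_isHermitian a b) := by
  obtain ⟨c, hc, hbc⟩ := BandSemicircle.exists_mul_le_of_liminf_pos hlim
  rcases h with ⟨α, hα, ⟨C, C', h⟩, hsign⟩ | ⟨α, C, C', D, hα, h, hsum⟩ | h
  · exact (h.aau1.momentBounds_of_sign hα hsign).semicircleLaw b hb hc hbc
  · exact (h.toAlmostUncorrelatedWith.momentBounds hα.le fun l hl => (hsum l hl).1).semicircleLaw
      b hb hc hbc
  · obtain ⟨C, hC⟩ := h.exists_momentBounds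
    exact hC.semicircleLaw b hb hc hbc
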